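/- Let $n\ge 2$ and, for $\alpha\in\mathbb C$ with $0<\operatorname{Re}\alpha<\frac{n+1}{2}$ and $\xi\in\mathbb R^n$, $|\xi|\neq 1$, put $$m_\alpha(|\xi|)=\frac{2\pi^{n/2}\,\Gamma(\alpha)\,e^{\alpha\pi i/2}}{\Gamma(n/2)}\;{}_2F_1\!\Big(\frac{\alpha}{2},\frac{\alpha+1}{2};\frac n2;|\xi|^2\Big)\qquad\text{if }|\xi|<1,$$ $$m_\alpha(|\xi|)=\frac{2^{\alpha}\pi^{n/2}\,\Gamma(\alpha/2)}{\Gamma((n-\alpha)/2)}|\xi|^{-\alpha}{}_2F_1\!\Big(\frac\alpha2,\frac{\alpha-n+2}{2};\frac12;\frac1{|\xi|^2}\Big)+i\,\frac{2^{\alpha+1}\pi^{n/2}\,\Gamma((\alpha+1)/2)}{\Gamma((n-\alpha-1)/2)}|\xi|^{-\alpha-1}{}_2F_1\!\Big(\frac{\alpha+1}2,\frac{\alpha-n+3}{2};\frac32;\frac1{|\xi|^2}\Big)\qquad\text{if }|\xi|>1,$$ where $1/\Gamma$ is read as $0$ at a pole of $\Gamma$. This is the symbol of the oscillatory potential $(K^\alpha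 f)(x)=\int_{\mathbb R^n}\frac{e^{i|y|}}{|y|^{n-\alpha}}f(x-y)\,dy$. It admits the following estimates. 1. For all real $\delta_0>0$ and $\delta_1<\frac{n-1}{2}$ there is a constant $C=C(n,\delta_0,\delta_1)$ such that, whenever $0<\operatorname{Re}\alpha\le\delta_1$, $|\alpha|\ge\delta_0$ and $|\xi|\ne 1$, $$|m_\alpha(|\xi|)|\le C\,\exp\!\Big(\frac{\pi}{2}|\operatorname{Im}\alpha|\Big).$$ 2. For every real $\delta_2<\frac{n+1}{2}$ there is a constant $C=C(n,\delta_2)$ such that, whenever $\frac{n-1}{2}\le\operatorname{Re}\alpha\le\delta_2$ and $\alpha\neq\frac{n-1}{2}$, $$|m_\alpha(|\xi|)|\le C\,\exp(\pi|\operatorname{Im}\alpha|)\begin{cases}1,&|\xi|\le\frac12\text{ or }|\xi|\ge2,\\[2pt] \big|\Gamma\big(\alpha-\frac{n-1}{2}\big)\big|\Big(1+\big|1-|\xi|\big|^{\frac{n-1}{2}-\operatorname{Re}\alpha}\Big),&\frac12<|\xi|<2,\ |\xi|\ne1.\end{cases}$$ 3. If $\alpha=\frac{n-1}{2}$, there is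 a constant $C=C(n)$ such that $$|m_\alpha(|\xi|)|\le C\begin{cases}1,&|\xi|\le\frac12\text{ or }|\xi|\ge2,\\[2pt] 1+\big|\ln\big|1-|\xi|\big|\big|,&\frac12<|\xi|<2,\ |\xi|\ne1.\end{cases}$$ -/

import Mathlib

/-- The symbol `m_α(r)`, `r = |ξ| ≠ 1`, of the oscillatory potential `K^α` on `ℝⁿ`, whose kernel is
`exp (i|y|) / |y|^(n-α)`. It is given by Gauss hypergeometric functions: a series in `r²` inside
the unit sphere and a sum of two series in `r⁻²` outside. The symbol is not defined on the unit
sphere itself, and the value of this function at `r = 1` has no meaning. For `n ≥ 2` and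
`0 < Re α < (n+1)/2` the only possible pole of a Gamma factor below is that of `Γ((n-α-1)/2)` at
`n = 2`, `α = 1`; there Mathlib's conventions give `1/Γ = 0`, the usual value of the entire
function `1/Γ` at a pole of `Γ`. -/
noncomputable def oscSymbol (n : ℕ) (α : ℂ) (r : ℝ) : ℂ :=
  if r < 1 then
    2 * (Real.pi : ℂ) ^ ((n : ℂ) / 2) * Complex.Gamma α *
        Complex.exp (α * Real.pi * Complex.I / 2) / Complex.Gamma ((n : ℂ) / 2) *
      ordinaryHypergeometric (α / 2) ((α + 1) / 2) ((n : ℂ) / 2) ((r : ℂ) ^ 2)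
  else
    (2 : ℂ) ^ α * (Real.pi : ℂ) ^ ((n : ℂ) / 2) * Complex.Gamma (α / 2) /
        Complex.Gamma (((n : ℂ) - α) / 2) * (r : ℂ) ^ (-α) *
      ordinaryHypergeometric (α / 2) ((α - n + 2) / 2) (1 / 2 : ℂ) (1 / (r : ℂ) ^ 2) +
    Complex.I * ((2 : ℂ) ^ (α + 1) * (Real.pi : ℂ) ^ ((n : ℂ) / 2) * Complex.Gamma ((α + 1) / 2) /
        Complex.Gamma (((n : ℂ) - α - 1) / 2)) * (r : ℂ) ^ (-α - 1) *
      ordinaryHypergeometric ((α + 1) / 2) ((α - n + 3) / 2) (3 / 2 : ℂ) (1 / (r : ℂ) ^ 2)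

/-! All three estimates come from one bound, uniform in `α`, on the hypergeometric functions near
their singular point `z = 1`. Put `z = tanh² t`, which sends `z = 1` to `t = ∞`, and multiply
`₂F₁(a, b; p + 1/2; z)` by `tanh^p t · cosh^(-s) t` with `s = a + b - c`, `c = p + 1/2`. The Gauss
equation becomes `v'' = (s² + Q) v` with `Q = (1 - tanh² t) (p(p-1)/tanh² t - ((a-b)² - 1/4))`,
which is `O(exp(-2t))` at infinity. For all three functions in the symbol `s = α - (n-1)/2`, while
`a - b` is `-1/2` inside the sphere and `(n-2)/2` outside. Hence `Q` does not depend on `α`, and all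
dependence on `α` sits in `s`, the Cauchy data and the Gamma factors.

Duhamel's formula and a Grönwall argument (`norm_le_of_schroedinger`) bound `v` by its Cauchy data
times `(1 + min(t, 1/|s|)) exp(|Re s| t)`. Undoing the factor `cosh^(-s)` leaves a bounded weight if
`Re s ≤ 0` and `(1 - tanh t)^(-Re s)`, up to constants, if `Re s ≥ 0`. The factor `t` is the
logarithm of the critical case; the factor `1/|s|` is absorbed by the pole of `Γ(s)` at `0`.

Outside the sphere `p` is `0` or `1`, so `Q` is regular and the data are taken near `t = 0`. Inside,
`p = (n-1)/2` and the data are taken at `tanh t = 1/8`, where the power series costs only `exp(|Im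
α|/4)`. With the strip bounds for `Γ` and `1/Γ` the total growth is `exp(π|Im α|/4)`
(`exists_norm_oscSymbol_le`), which leaves room in every estimate. -/

/-! ### Growth of the Gamma function on vertical lines and strips -/

theorem norm_betaIntegral_ofReal_le (z : ℂ) (d : ℝ) :
    ‖Complex.betaIntegral z d‖ ≤ ‖Complex.betaIntegral (z.re : ℂ) d‖ := by
  have key : ∀ w : ℂ, ∀ x ∈ Set.uIoc (0 : ℝ) 1, x ≠ 1 →
      ‖(x : ℂ) ^ (w - 1) * (1 - (x : ℂ)) ^ ((d : ℂ) - 1)‖ =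
        x ^ (w.re - 1) * (1 - x) ^ (d - 1) := by
    intro w x hx hx1
    rw [Set.uIoc_of_le zero_le_one] at hx
    have h1 : (0 : ℝ) < 1 - x := sub_pos.2 (lt_of_le_of_ne hx.2 hx1)
    rw [norm_mul, Complex.norm_cpow_eq_rpow_re_of_pos hx.1,
      show (1 - (x : ℂ)) = ((1 - x : ℝ) : ℂ) by push_cast; rfl,
      Complex.norm_cpow_eq_rpow_re_of_pos h1]
    simp
  have hne : ∀ᵐ x : ℝ, x ≠ 1 := by simp [MeasureTheory.ae_iff]
  have h2 : Complex.betaIntegral (z.re : ℂ) d =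
      ((∫ x in (0 : ℝ)..1, x ^ (z.re - 1) * (1 - x) ^ (d - 1) : ℝ) : ℂ) := by
    rw [Complex.betaIntegral, ← intervalIntegral.integral_ofReal]
    refine intervalIntegral.integral_congr fun x hx => ?_
    rw [Set.uIcc_of_le zero_le_one] at hx
    have h1 : (0 : ℝ) ≤ 1 - x := sub_nonneg.2 hx.2
    push_cast
    rw [Complex.ofReal_cpow hx.1, Complex.ofReal_cpow h1]
    push_cast
    rfl
  calc ‖Complex.betaIntegral z d‖
      ≤ ∫ x in (0 : ℝ)..1, ‖(x : ℂ) ^ (z - 1) * (1 - (x : ℂ)) ^ ((d : ℂ) - 1)‖ :=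
        intervalIntegral.norm_integral_le_integral_norm zero_le_one
    _ = ∫ x in (0 : ℝ)..1, x ^ (z.re - 1) * (1 - x) ^ (d - 1) := by
        refine intervalIntegral.integral_congr_ae ?_
        filter_upwards [hne] with x hx1 hx using key z x hx hx1
    _ ≤ ‖Complex.betaIntegral (z.re : ℂ) d‖ := by
        rw [h2, Complex.norm_real]
        exact Real.le_norm_self _

/-- The quotient `|Γ(x + iy)| / Γ(x)` is nondecreasing in `x > 0`. -/
theorem norm_Gamma_mul_Gamma_add_le {z : ℂ} {d : ℝ} (hz : 0 < z.re) (hd : 0 < d) :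
    ‖Complex.Gamma z‖ * Real.Gamma (z.re + d) ≤ ‖Complex.Gamma (z + d)‖ * Real.Gamma z.re := by
  -- `Γ(z) Γ(d) = Γ(z + d) B(z, d)` is used at `z` and at `Re z`; the modulus of the Beta integral
  -- is largest at the real point.
  have h1 := Complex.Gamma_mul_Gamma_eq_betaIntegral hz (t := (d : ℂ)) (by simpa using hd)
  have h2 := Complex.Gamma_mul_Gamma_eq_betaIntegral (s := (z.re : ℂ)) (t := (d : ℂ))
    (by simpa using hz) (by simpa using hd)
  have n1 := congrArg norm h1
  have n2 := congrArg norm h2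
  rw [norm_mul, norm_mul] at n1 n2
  rw [← Complex.ofReal_add, Complex.Gamma_ofReal, Complex.Gamma_ofReal, Complex.Gamma_ofReal,
    Complex.norm_real, Complex.norm_real, Complex.norm_real,
    Real.norm_of_nonneg (Real.Gamma_pos_of_pos hz).le,
    Real.norm_of_nonneg (Real.Gamma_pos_of_pos hd).le,
    Real.norm_of_nonneg (Real.Gamma_pos_of_pos (add_pos hz hd)).le] at n2
  rw [Complex.Gamma_ofReal, Complex.norm_real,
    Real.norm_of_nonneg (Real.Gamma_pos_of_pos hd).le] at n1
  have hG := Real.Gamma_pos_of_pos hd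
  have hb := norm_betaIntegral_ofReal_le z d
  refine le_of_mul_le_mul_right ?_ hG
  calc ‖Complex.Gamma z‖ * Real.Gamma (z.re + d) * Real.Gamma d
      = ‖Complex.Gamma (z + d)‖ * Real.Gamma (z.re + d) * ‖Complex.betaIntegral z d‖ := by
        linear_combination Real.Gamma (z.re + d) * n1
    _ ≤ ‖Complex.Gamma (z + d)‖ * Real.Gamma (z.re + d) * ‖Complex.betaIntegral (z.re : ℂ) d‖ := by
        have := (Real.Gamma_pos_of_pos (add_pos hz hd)).le
        gcongr
    _ = ‖Complex.Gamma (z + d)‖ * Real.Gamma z.re * Real.Gamma d := by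
        linear_combination -‖Complex.Gamma (z + d)‖ * n2

/-- On the line `Re z = 1/2` one has `1 - z = conj z`, so the reflection formula computes the
modulus exactly. The other vertical lines are compared with this one. -/
theorem norm_Gamma_half_add_mul_I_sq (y : ℝ) :
    ‖Complex.Gamma (1 / 2 + y * Complex.I)‖ ^ 2 = Real.pi / Real.cosh (Real.pi * y) := by
  have h := Complex.Gamma_mul_Gamma_one_sub (1 / 2 + y * Complex.I)
  have h1 : (1 : ℂ) - (1 / 2 + y * Complex.I) = (starRingEnd ℂ) (1 / 2 + y * Complex.I) := by
    apply Complex.ext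
    · simp
      norm_num
    · simp
  have h2 : Complex.sin (Real.pi * (1 / 2 + y * Complex.I)) = (Real.cosh (Real.pi * y) : ℂ) := by
    rw [show (Real.pi : ℂ) * (1 / 2 + y * Complex.I)
      = (Real.pi * y : ℂ) * Complex.I + Real.pi / 2 by ring, Complex.sin_add_pi_div_two,
      Complex.cos_mul_I]
    push_cast
    rfl
  rw [h1, Complex.Gamma_conj, Complex.mul_conj, h2, Complex.normSq_eq_norm_sq] at h
  exact_mod_cast h

theorem norm_Gamma_half_add_mul_I_le (y : ℝ) :
    ‖Complex.Gamma (1 / 2 + y * Complex.I)‖ ≤ 3 * Real.exp (-(Real.pi / 2) * |y|) := by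
  refine le_of_sq_le_sq ?_ (by positivity)
  rw [norm_Gamma_half_add_mul_I_sq, ← Real.cosh_abs, abs_mul, abs_of_pos Real.pi_pos, mul_pow,
    ← Real.exp_nat_mul, Real.cosh_eq, div_le_iff₀ (by positivity)]
  have h1 : Real.exp ((2 : ℕ) * (-(Real.pi / 2) * |y|)) * Real.exp (Real.pi * |y|) = 1 := by
    rw [← Real.exp_add, ← Real.exp_zero]
    congr 1
    push_cast
    ring
  have h2 : 0 < Real.exp ((2 : ℕ) * (-(Real.pi / 2) * |y|)) * Real.exp (-(Real.pi * |y|)) := by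
    positivity
  have := Real.pi_lt_four
  nlinarith

theorem le_norm_Gamma_half_add_mul_I (y : ℝ) :
    Real.exp (-(Real.pi / 2) * |y|) ≤ ‖Complex.Gamma (1 / 2 + y * Complex.I)‖ := by
  refine le_of_sq_le_sq ?_ (by positivity)
  rw [norm_Gamma_half_add_mul_I_sq, ← Real.cosh_abs, abs_mul, abs_of_pos Real.pi_pos,
    ← Real.exp_nat_mul, Real.cosh_eq, le_div_iff₀ (by positivity)]
  have h1 : Real.exp ((2 : ℕ) * (-(Real.pi / 2) * |y|)) * Real.exp (Real.pi * |y|) = 1 := by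
    rw [← Real.exp_add, ← Real.exp_zero]
    congr 1
    push_cast
    ring
  have h2 : Real.exp (-(Real.pi * |y|)) ≤ Real.exp (Real.pi * |y|) := by
    apply Real.exp_le_exp.2
    have : 0 ≤ Real.pi * |y| := by positivity
    linarith
  have h3 := mul_le_mul_of_nonneg_left h2 (Real.exp_pos ((2 : ℕ) * (-(Real.pi / 2) * |y|))).le
  have := Real.pi_gt_three
  nlinarith

theorem exists_add_pow_le_mul_exp (A : ℝ) (hA : 0 ≤ A) (m : ℕ) {ε : ℝ} (hε : 0 < ε) :
    ∃ C : ℝ, 0 < C ∧ ∀ y : ℝ, 0 ≤ y → (A + y) ^ m ≤ C * Real.exp (ε * y) := by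
  refine ⟨m.factorial / ε ^ m * Real.exp (ε * A), by positivity, fun y hy => ?_⟩
  have h := Real.pow_div_factorial_le_exp (ε * (A + y)) (by positivity) m
  rw [mul_pow, mul_add, Real.exp_add, div_le_iff₀ (by positivity)] at h
  rw [div_mul_eq_mul_div, div_mul_eq_mul_div, le_div_iff₀ (by positivity)]
  linarith

theorem norm_Gamma_nat_add_half_le (m : ℕ) (y : ℝ) :
    ‖Complex.Gamma (m + 1 / 2 + y * Complex.I)‖ ≤
      (m + 1 / 2 + |y|) ^ m * ‖Complex.Gamma (1 / 2 + y * Complex.I)‖ := by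
  induction m with
  | zero => simp
  | succ k ih =>
    have h0 : (k : ℂ) + 1 / 2 + y * Complex.I ≠ 0 := by
      intro h
      have := congrArg Complex.re h
      simp at this
      have : (0 : ℝ) ≤ k := k.cast_nonneg
      linarith
    rw [show ((k + 1 : ℕ) : ℂ) + 1 / 2 + y * Complex.I = (k + 1 / 2 + y * Complex.I) + 1 by
      push_cast; ring, Complex.Gamma_add_one _ h0, norm_mul]
    have h1 : ‖(k : ℂ) + 1 / 2 + y * Complex.I‖ ≤ k + 1 / 2 + |y| := by
      refine (norm_add_le _ _).trans (add_le_add ?_ (by simp))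
      rw [show (k : ℂ) + 1 / 2 = ((k + 1 / 2 : ℝ) : ℂ) by push_cast; rfl, Complex.norm_real]
      exact (Real.norm_of_nonneg (by positivity)).le
    calc _ ≤ (k + 1 / 2 + |y|) * ((k + 1 / 2 + |y|) ^ k *
          ‖Complex.Gamma (1 / 2 + y * Complex.I)‖) := by gcongr
      _ = (k + 1 / 2 + |y|) ^ (k + 1) * ‖Complex.Gamma (1 / 2 + y * Complex.I)‖ := by ring
      _ ≤ _ := by
        gcongr
        linarith

theorem exists_real_Gamma_le (R : ℝ) : ∃ C : ℝ, 0 < C ∧ ∀ x : ℝ, 1 ≤ x → x ≤ R →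
    Real.Gamma x ≤ C ∧ 1 ≤ C * Real.Gamma x := by
  have hc : ContinuousOn Real.Gamma (Set.Icc 1 R) := fun x hx =>
    (Real.differentiableAt_Gamma fun m h => by
      have : (0 : ℝ) ≤ m := m.cast_nonneg
      linarith [hx.1]).continuousAt.continuousWithinAt
  have hc' : ContinuousOn (fun x => (Real.Gamma x)⁻¹) (Set.Icc 1 R) :=
    hc.inv₀ fun x hx => (Real.Gamma_pos_of_pos (by linarith [hx.1])).ne'
  obtain ⟨C₁, h₁⟩ := isCompact_Icc.exists_bound_of_continuousOn hc
  obtain ⟨C₂, h₂⟩ := isCompact_Icc.exists_bound_of_continuousOn hc'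
  refine ⟨max 1 (max C₁ C₂), by positivity, fun x h1 hR => ⟨?_, ?_⟩⟩
  · exact (Real.le_norm_self _).trans ((h₁ x ⟨h1, hR⟩).trans (by simp))
  · have hG : 0 < Real.Gamma x := Real.Gamma_pos_of_pos (by linarith)
    have := (Real.le_norm_self _).trans ((h₂ x ⟨h1, hR⟩).trans
      ((le_max_right C₁ C₂).trans (le_max_right 1 _)))
    rwa [inv_eq_one_div, div_le_iff₀ hG] at this

/-- Decay of the Gamma function on vertical strips of the right half plane. -/
theorem exists_norm_Gamma_le (R δ : ℝ) (hδ : 0 < δ) :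
    ∃ C : ℝ, 0 < C ∧ ∀ z : ℂ, 0 < z.re → z.re ≤ R → δ ≤ ‖z‖ →
      ‖Complex.Gamma z‖ ≤ C * Real.exp (-(Real.pi / 3) * |z.im|) := by
  obtain ⟨m, hm⟩ := exists_nat_gt (R + 1)
  obtain ⟨C₁, hC₁, h₁⟩ := exists_real_Gamma_le (m + 1 / 2)
  -- On the line `Re = m + 1/2` the decay is a polynomial times `exp(-π|y|/2)`; giving up `π/6` of
  -- the rate absorbs the polynomial and leaves `π/3`.
  obtain ⟨C₂, hC₂, h₂⟩ := exists_add_pow_le_mul_exp (m + 1 / 2) (by positivity) m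
    (ε := Real.pi / 6) (by positivity)
  refine ⟨C₁ * C₁ * C₂ * 3 / δ, by positivity, fun z hz hR hzδ => ?_⟩
  have hz0 : z ≠ 0 := by rintro rfl; simp at hz
  have hd : 0 < (m : ℝ) + 1 / 2 - (z.re + 1) := by linarith
  -- Comparison to the right, with the line `Re = m + 1/2`. It starts from `z + 1`, away from the
  -- pole at `0`; the factor `z` in `Γ(z + 1) = z Γ(z)` is then divided out using `δ ≤ ‖z‖`.
  have h3 := norm_Gamma_mul_Gamma_add_le (z := z + 1) (by simp; linarith) hd
  have e1 : (z + 1).re + ((m : ℝ) + 1 / 2 - (z.re + 1)) = m + 1 / 2 := by simp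
  have e2 : z + 1 + (((m : ℝ) + 1 / 2 - (z.re + 1) : ℝ) : ℂ) = m + 1 / 2 + z.im * Complex.I := by
    apply Complex.ext <;> simp
  rw [e1, e2, Complex.Gamma_add_one _ hz0, norm_mul] at h3
  have h4 := (h₁ (m + 1 / 2) (by linarith) le_rfl).2
  have h5 := (h₁ (z + 1).re (by simp; linarith) (by simp; linarith)).1
  have h6 := (norm_Gamma_nat_add_half_le m z.im).trans (mul_le_mul (h₂ _ (abs_nonneg z.im))
    (norm_Gamma_half_add_mul_I_le z.im) (norm_nonneg _) (by positivity))
  have h7 : C₂ * Real.exp (Real.pi / 6 * |z.im|) * (3 * Real.exp (-(Real.pi / 2) * |z.im|)) =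
      C₂ * 3 * Real.exp (-(Real.pi / 3) * |z.im|) := by
    rw [show -(Real.pi / 3) * |z.im| = Real.pi / 6 * |z.im| + -(Real.pi / 2) * |z.im| by ring,
      Real.exp_add]
    ring
  rw [h7] at h6
  have h8 : 0 < Real.Gamma (m + 1 / 2) := Real.Gamma_pos_of_pos (by positivity)
  have h9 : 0 < Real.Gamma (z + 1).re := Real.Gamma_pos_of_pos (by simp; linarith)
  rw [div_mul_eq_mul_div, le_div_iff₀ hδ]
  calc ‖Complex.Gamma z‖ * δ ≤ ‖z‖ * ‖Complex.Gamma z‖ * 1 := by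
        rw [mul_one, mul_comm]; gcongr
    _ ≤ ‖z‖ * ‖Complex.Gamma z‖ * (C₁ * Real.Gamma (m + 1 / 2)) := by gcongr
    _ = C₁ * (‖z‖ * ‖Complex.Gamma z‖ * Real.Gamma (m + 1 / 2)) := by ring
    _ ≤ C₁ * ((C₂ * 3 * Real.exp (-(Real.pi / 3) * |z.im|)) * C₁) := by
        refine mul_le_mul_of_nonneg_left (h3.trans ?_) hC₁.le
        gcongr
    _ = _ := by ring

/-- Growth of the reciprocal of the Gamma function on vertical strips. -/
theorem exists_norm_inv_Gamma_le (R : ℝ) :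
    ∃ C : ℝ, 0 < C ∧ ∀ z : ℂ, -(1 / 2) ≤ z.re → z.re ≤ R →
      ‖(Complex.Gamma z)⁻¹‖ ≤ C * Real.exp (2 * Real.pi / 3 * |z.im|) := by
  obtain ⟨C₁, hC₁, h₁⟩ := exists_real_Gamma_le (R + 2)
  obtain ⟨C₂, hC₂, h₂⟩ := exists_add_pow_le_mul_exp (|R| + 2) (by positivity) 2
    (ε := Real.pi / 6) (by positivity)
  have hG2 : 0 < Real.Gamma (1 / 2) := Real.Gamma_pos_of_pos (by norm_num)
  refine ⟨C₁ * C₂ * Real.Gamma (1 / 2), by positivity, fun z hz hR => ?_⟩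
  have hd : 0 < z.re + 2 - 1 / 2 := by linarith
  -- Comparison to the left this time: the line `Re = 1/2` bounds `Γ(z + 2)` from below. The factor
  -- `z (z + 1)` in `1/Γ(z) = z (z + 1)/Γ(z + 2)`, valid also at the poles, raises the rate from
  -- `π/2` to `2π/3`.
  have h3 := norm_Gamma_mul_Gamma_add_le (z := 1 / 2 + z.im * Complex.I) (by simp) hd
  have e1 : (1 / 2 + z.im * Complex.I).re + (z.re + 2 - 1 / 2) = z.re + 2 := by simp
  have e3 : (1 / 2 + z.im * Complex.I).re = 1 / 2 := by simp
  have e2 : 1 / 2 + z.im * Complex.I + ((z.re + 2 - 1 / 2 : ℝ) : ℂ) = z + 2 := by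
    apply Complex.ext <;> simp
  rw [e1, e2, e3] at h3
  have h4 := (h₁ (z.re + 2) (by linarith) (by linarith)).2
  have h5 : 0 < ‖Complex.Gamma (z + 2)‖ := norm_pos_iff.2
    (Complex.Gamma_ne_zero_of_re_pos (by simp; linarith))
  have h6 := le_norm_Gamma_half_add_mul_I z.im
  have h7 : ‖(Complex.Gamma (z + 2))⁻¹‖ ≤
      C₁ * Real.Gamma (1 / 2) * Real.exp (Real.pi / 2 * |z.im|) := by
    rw [norm_inv, inv_eq_one_div, div_le_iff₀ h5]
    have h8 : Real.exp (Real.pi / 2 * |z.im|) * Real.exp (-(Real.pi / 2) * |z.im|) = 1 := by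
      rw [← Real.exp_add, ← Real.exp_zero]
      congr 1
      ring
    calc 1 = Real.exp (Real.pi / 2 * |z.im|) * Real.exp (-(Real.pi / 2) * |z.im|) * 1 := by
          rw [h8, one_mul]
      _ ≤ Real.exp (Real.pi / 2 * |z.im|) * ‖Complex.Gamma (1 / 2 + z.im * Complex.I)‖ *
          (C₁ * Real.Gamma (z.re + 2)) := by gcongr
      _ = Real.exp (Real.pi / 2 * |z.im|) * C₁ *
          (‖Complex.Gamma (1 / 2 + z.im * Complex.I)‖ * Real.Gamma (z.re + 2)) := by ring
      _ ≤ Real.exp (Real.pi / 2 * |z.im|) * C₁ *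
          (‖Complex.Gamma (z + 2)‖ * Real.Gamma (1 / 2)) := by gcongr
      _ = _ := by ring
  have h8 : ‖z * (z + 1)‖ ≤ (|R| + 2 + |z.im|) ^ 2 := by
    have hre : |z.re| ≤ |R| + 1 := by
      rw [abs_le]
      constructor
      · linarith [abs_nonneg R]
      · linarith [le_abs_self R]
    have ha := Complex.norm_le_abs_re_add_abs_im z
    have hb := (norm_add_le z 1)
    rw [norm_one] at hb
    rw [norm_mul, pow_two]
    gcongr <;> linarith
  rw [Complex.one_div_Gamma_eq_self_mul_one_div_Gamma_add_one,
    Complex.one_div_Gamma_eq_self_mul_one_div_Gamma_add_one (z + 1), ← mul_assoc, norm_mul,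
    show z + 1 + 1 = z + 2 by ring]
  calc _ ≤ (C₂ * Real.exp (Real.pi / 6 * |z.im|)) *
        (C₁ * Real.Gamma (1 / 2) * Real.exp (Real.pi / 2 * |z.im|)) :=
        mul_le_mul (h8.trans (h₂ _ (abs_nonneg _))) h7 (norm_nonneg _) (by positivity)
    _ = _ := by
        rw [show 2 * Real.pi / 3 * |z.im| = Real.pi / 6 * |z.im| + Real.pi / 2 * |z.im| by ring,
          Real.exp_add]
        ring

/-! ### Hypergeometric series: convergence, derivative and differential equation -/

theorem HasSum.congr_term {f g : ℕ → ℂ} {x : ℂ} (h : HasSum f x) (hfg : ∀ k, g k = f k) :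
    HasSum g x :=
  (funext hfg : g = f) ▸ h

/-- The radius is `1` unless a parameter is a nonpositive integer. In that case the series
terminates, for `c` because the inverse of zero is read as zero. -/
theorem one_le_radius_ordinaryHypergeometricSeries (a b c : ℂ) :
    1 ≤ (ordinaryHypergeometricSeries ℂ a b c).radius := by
  by_cases h : ∀ k : ℕ, (k : ℂ) ≠ -a ∧ (k : ℂ) ≠ -b ∧ (k : ℂ) ≠ -c
  · exact (ordinaryHypergeometricSeries_radius_eq_one ℂ a b c h).ge
  · push Not at h
    obtain ⟨k, hk⟩ := h
    by_cases ha : (k : ℂ) = -a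
    · rw [show a = -(k : ℂ) by rw [ha, neg_neg], ordinaryHypergeometric_radius_top_of_neg_nat₁]
      exact le_top
    by_cases hb : (k : ℂ) = -b
    · rw [show b = -(k : ℂ) by rw [hb, neg_neg], ordinaryHypergeometric_radius_top_of_neg_nat₂]
      exact le_top
    · rw [show c = -(k : ℂ) by rw [hk ha hb, neg_neg],
        ordinaryHypergeometric_radius_top_of_neg_nat₃]
      exact le_top

theorem mem_eball_radius_ordinaryHypergeometricSeries (a b c : ℂ) {z : ℂ} (hz : ‖z‖ < 1) :
    z ∈ Metric.eball 0 (ordinaryHypergeometricSeries ℂ a b c).radius := by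
  refine Metric.eball_subset_eball (one_le_radius_ordinaryHypergeometricSeries a b c) ?_
  rw [Metric.mem_eball, edist_zero_right, ← ofReal_norm, ← ENNReal.ofReal_one]
  exact (ENNReal.ofReal_lt_ofReal_iff one_pos).2 hz

theorem hasSum_ordinaryHypergeometric (a b c : ℂ) {z : ℂ} (hz : ‖z‖ < 1) :
    HasSum (fun k => ordinaryHypergeometricCoefficient a b c k * z ^ k)
      (ordinaryHypergeometric a b c z) := by
  have h := FormalMultilinearSeries.hasSum _
    (mem_eball_radius_ordinaryHypergeometricSeries a b c hz)
  refine h.congr_term fun k => ?_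
  rw [ordinaryHypergeometricSeries_apply_eq, smul_eq_mul]

theorem ordinaryHypergeometricCoefficient_recurrence (a b c : ℂ) (k : ℕ) (hc : c + k ≠ 0) :
    ((k : ℂ) + 1) * (c + k) * ordinaryHypergeometricCoefficient a b c (k + 1) =
      (a + k) * (b + k) * ordinaryHypergeometricCoefficient a b c k := by
  simp only [ordinaryHypergeometricCoefficient, ascPochhammer_succ_eval, Nat.factorial_succ]
  have : (k : ℂ) + 1 ≠ 0 := Nat.cast_add_one_ne_zero k
  push_cast
  rw [mul_inv, mul_inv]
  field_simp

theorem ascPochhammer_succ_eval_left (a : ℂ) (k : ℕ) :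
    (ascPochhammer ℂ (k + 1)).eval a = a * (ascPochhammer ℂ k).eval (a + 1) := by
  simp [ascPochhammer_succ_left]

theorem ordinaryHypergeometricCoefficient_succ (a b c : ℂ) (k : ℕ) :
    ((k : ℂ) + 1) * ordinaryHypergeometricCoefficient a b c (k + 1) =
      a * b / c * ordinaryHypergeometricCoefficient (a + 1) (b + 1) (c + 1) k := by
  simp only [ordinaryHypergeometricCoefficient, ascPochhammer_succ_eval_left, Nat.factorial_succ]
  have : (k : ℂ) + 1 ≠ 0 := Nat.cast_add_one_ne_zero k
  push_cast
  rw [mul_inv, mul_inv]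
  field_simp

theorem hasDerivAt_ordinaryHypergeometric (a b c : ℂ) {z : ℂ} (hz : ‖z‖ < 1) :
    HasDerivAt (ordinaryHypergeometric a b c)
      (a * b / c * ordinaryHypergeometric (a + 1) (b + 1) (c + 1) z) z := by
  set p := ordinaryHypergeometricSeries ℂ a b c with hp
  have hr : 0 < p.radius := one_pos.trans_le (one_le_radius_ordinaryHypergeometricSeries a b c)
  have hmem := mem_eball_radius_ordinaryHypergeometricSeries a b c hz
  have h := p.hasFPowerSeriesOnBall hr
  have hd : DifferentiableAt ℂ p.sum z :=
    (h.analyticAt_of_mem hmem).differentiableAt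
  have h1 := h.fderiv.hasSum hmem
  rw [zero_add] at h1
  have h2 := h1.mapL (ContinuousLinearMap.apply ℂ ℂ (1 : ℂ))
  have h3 : HasSum (fun k => a * b / c *
      (ordinaryHypergeometricCoefficient (a + 1) (b + 1) (c + 1) k * z ^ k)) (deriv p.sum z) := by
    refine h2.congr_term fun k => ?_
    rw [← mul_assoc, ← ordinaryHypergeometricCoefficient_succ]
    have h4 : (p.derivSeries k fun _ => z) = z ^ k • p.derivSeries.coeff k := by
      rw [← FormalMultilinearSeries.apply_eq_pow_smul_coeff]
    rw [ContinuousLinearMap.apply_apply, h4, smul_apply,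
      FormalMultilinearSeries.derivSeries_coeff_one, hp, ordinaryHypergeometricSeries,
      FormalMultilinearSeries.coeff_ofScalars]
    simp only [smul_eq_mul, nsmul_eq_mul]
    push_cast
    ring
  have h4 := (hasSum_ordinaryHypergeometric (a + 1) (b + 1) (c + 1) hz).mul_left (a * b / c)
  rw [← h3.unique h4]
  exact hd.hasDerivAt

/-- The Gauss hypergeometric differential equation. -/
theorem ordinaryHypergeometric_ode (a b c : ℂ) (hc : ∀ k : ℕ, c + k ≠ 0) {z : ℂ} (hz : ‖z‖ < 1)
    {F F₁ F₂ : ℂ} (hF : F = ordinaryHypergeometric a b c z)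
    (hF₁ : F₁ = a * b / c * ordinaryHypergeometric (a + 1) (b + 1) (c + 1) z)
    (hF₂ : F₂ = a * b / c * ((a + 1) * (b + 1) / (c + 1) *
      ordinaryHypergeometric (a + 1 + 1) (b + 1 + 1) (c + 1 + 1) z)) :
    z * (1 - z) * F₂ + (c - (a + b + 1) * z) * F₁ - a * b * F = 0 := by
  set t := ordinaryHypergeometricCoefficient a b c with ht
  have s0 : HasSum (fun k : ℕ => t k * z ^ k) F :=
    hF ▸ hasSum_ordinaryHypergeometric a b c hz
  have s1 : HasSum (fun k : ℕ => (k + 1) * t (k + 1) * z ^ k) F₁ := by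
    have := (hasSum_ordinaryHypergeometric (a + 1) (b + 1) (c + 1) hz).mul_left (a * b / c)
    rw [hF₁]
    refine this.congr_term fun k => ?_
    rw [ordinaryHypergeometricCoefficient_succ]
    ring
  have s2 : HasSum (fun k : ℕ => (k + 1) * ((k + 2) * t (k + 2)) * z ^ k) F₂ := by
    have := ((hasSum_ordinaryHypergeometric (a + 1 + 1) (b + 1 + 1) (c + 1 + 1) hz).mul_left
      ((a + 1) * (b + 1) / (c + 1))).mul_left (a * b / c)
    rw [hF₂]
    refine this.congr_term fun k => ?_
    have e1 := ordinaryHypergeometricCoefficient_succ a b c (k + 1)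
    have e2 := ordinaryHypergeometricCoefficient_succ (a + 1) (b + 1) (c + 1) k
    push_cast at e1
    rw [show (k : ℂ) + 2 = k + 1 + 1 by ring, e1,
      show (k + 1 : ℂ) * (a * b / c * ordinaryHypergeometricCoefficient (a + 1) (b + 1) (c + 1)
        (k + 1)) * z ^ k = a * b / c * ((k + 1 : ℂ) * ordinaryHypergeometricCoefficient (a + 1)
        (b + 1) (c + 1) (k + 1)) * z ^ k by ring, e2]
    ring
  -- Multiplication by `z` or `z²` shifts the index; the terms added at the start vanish through the
  -- factors `k` and `k - 1`. The equation then holds coefficientwise, by the recurrence.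
  have r1 : HasSum (fun k : ℕ => k * t k * z ^ k) (z * F₁) := by
    have := (hasSum_nat_add_iff (f := fun k : ℕ => k * t k * z ^ k) 1).1
      ((s1.mul_left z).congr_term fun k => by push_cast; ring)
    simpa using this
  have r2 : HasSum (fun k : ℕ => k * (k - 1) * t k * z ^ k) (z ^ 2 * F₂) := by
    have := (hasSum_nat_add_iff (f := fun k : ℕ => k * (k - 1) * t k * z ^ k) 2).1
      ((s2.mul_left (z ^ 2)).congr_term fun k => by push_cast; ring)
    simpa [Finset.sum_range_succ] using this
  have r3 : HasSum (fun k : ℕ => (k + 1) * k * t (k + 1) * z ^ k) (z * F₂) := by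
    have := (hasSum_nat_add_iff (f := fun k : ℕ => (k + 1) * k * t (k + 1) * z ^ k) 1).1
      ((s2.mul_left z).congr_term fun k => by push_cast; ring)
    simpa using this
  have total := ((r3.add (s1.mul_left c)).sub r2).sub ((r1.mul_left (a + b + 1)).add
    (s0.mul_left (a * b)))
  have zero : (fun k : ℕ => (k + 1) * k * t (k + 1) * z ^ k + c * ((k + 1) * t (k + 1) * z ^ k) -
      k * (k - 1) * t k * z ^ k - ((a + b + 1) * (k * t k * z ^ k) + a * b * (t k * z ^ k))) =
      fun _ => (0 : ℂ) := by
    ext k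
    have := ordinaryHypergeometricCoefficient_recurrence a b c k (hc k)
    rw [← ht] at this
    linear_combination z ^ k * this
  rw [zero] at total
  have := total.unique hasSum_zero
  linear_combination this

/-! ### Exponentially small perturbations of `y'' = s² y` -/

/-- A Grönwall inequality with the kernel `D exp (-2τ)` and a weight `M` of at most linear growth. -/
theorem le_mul_exp_of_le_integral {u M : ℝ → ℝ} {K D : ℝ} (hK : 0 ≤ K) (hD : 0 ≤ D)
    -- The bracket `R` on the right of `h` satisfies `R' ≤ D exp(-2t) (1 + t) R ≤ D exp(-t) R`.
    -- Hence `R(t) exp(D exp(-t))` is nonincreasing and `R(t) ≤ K exp D` for all `t ≥ 0`.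
    (hu : ContinuousOn u (Set.Ici 0)) (hu0 : ∀ t, 0 ≤ t → 0 ≤ u t)
    (hM0 : ∀ t, 0 ≤ t → 0 ≤ M t) (hM : ∀ t, 0 ≤ t → M t ≤ 1 + t)
    (h : ∀ t, 0 ≤ t → u t ≤ M t * (K + ∫ τ in (0 : ℝ)..t, D * Real.exp (-2 * τ) * u τ)) {t : ℝ}
    (ht : 0 ≤ t) : u t ≤ K * Real.exp D * M t := by
  -- Replacing `τ` by `max τ 0` extends the integrand continuously to the whole line, so that its
  -- integral is differentiable also at `0`.
  set w : ℝ → ℝ := fun τ => D * Real.exp (-2 * τ) * u (max τ 0) with hw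
  have hwc : Continuous w := by
    refine (by fun_prop : Continuous fun τ : ℝ => D * Real.exp (-2 * τ)).mul
      (hu.comp_continuous (by fun_prop) fun τ => le_max_right τ 0)
  have hI : ∀ t, 0 ≤ t → ∫ τ in (0 : ℝ)..t, D * Real.exp (-2 * τ) * u τ = ∫ τ in (0 : ℝ)..t, w τ := by
    intro t ht
    refine intervalIntegral.integral_congr fun τ hτ => ?_
    rw [Set.uIcc_of_le ht] at hτ
    simp only [hw, max_eq_left hτ.1]
  set R : ℝ → ℝ := fun t => K + ∫ τ in (0 : ℝ)..t, w τ with hR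
  have hRd : ∀ t, HasDerivAt R (w t) t := fun t =>
    (hwc.integral_hasStrictDerivAt 0 t).hasDerivAt.const_add K
  have hw0 : ∀ τ, 0 ≤ w τ := fun τ =>
    mul_nonneg (by positivity) (hu0 _ (le_max_right _ _))
  have hR0 : ∀ t, 0 ≤ t → 0 ≤ R t := fun t ht =>
    add_nonneg hK (intervalIntegral.integral_nonneg ht fun τ _ => hw0 τ)
  have hE : ∀ t : ℝ, HasDerivAt (fun t : ℝ => Real.exp (D * Real.exp (-t)))
      (Real.exp (D * Real.exp (-t)) * (D * (Real.exp (-t) * -1))) t := fun t =>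
    (((hasDerivAt_neg t).exp).const_mul D).exp
  have hg : ∀ t, HasDerivAt (fun t => R t * Real.exp (D * Real.exp (-t)))
      (w t * Real.exp (D * Real.exp (-t)) +
        R t * (Real.exp (D * Real.exp (-t)) * (D * (Real.exp (-t) * -1)))) t := fun t =>
    (hRd t).mul (hE t)
  have hanti : AntitoneOn (fun t => R t * Real.exp (D * Real.exp (-t))) (Set.Ici 0) := by
    refine antitoneOn_of_deriv_nonpos (convex_Ici 0)
      (fun t _ => (hg t).continuousAt.continuousWithinAt)
      (fun t _ => (hg t).differentiableAt.differentiableWithinAt) fun t ht => ?_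
    rw [interior_Ici] at ht
    have ht : 0 < t := ht
    rw [(hg t).deriv]
    have h1 : w t ≤ D * Real.exp (-t) * R t := by
      have h2 := h t ht.le
      rw [hI t ht.le] at h2
      have h3 : Real.exp (-2 * t) * (1 + t) ≤ Real.exp (-t) := by
        rw [show -t = -2 * t + t by ring, Real.exp_add]
        gcongr
        linarith [Real.add_one_le_exp t]
      calc w t = D * Real.exp (-2 * t) * u t := by simp only [hw, max_eq_left ht.le]
        _ ≤ D * Real.exp (-2 * t) * ((1 + t) * R t) := by
          gcongr
          exact h2.trans (mul_le_mul_of_nonneg_right (hM t ht.le) (hR0 t ht.le))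
        _ = D * (Real.exp (-2 * t) * (1 + t)) * R t := by ring
        _ ≤ _ := by
          have := hR0 t ht.le
          gcongr
    have h4 := Real.exp_pos (D * Real.exp (-t))
    nlinarith
  have h5 := hanti (Set.mem_Ici.2 le_rfl) (Set.mem_Ici.2 ht) ht
  have h6 : R 0 = K := by simp [hR]
  simp only [h6, neg_zero, Real.exp_zero, mul_one] at h5
  have h7 : R t ≤ K * Real.exp D := by
    refine le_trans ?_ h5
    exact le_mul_of_one_le_right (hR0 t ht) (Real.one_le_exp (by positivity))
  have h8 := h t ht
  rw [hI t ht] at h8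
  calc u t ≤ M t * R t := h8
    _ ≤ M t * (K * Real.exp D) := mul_le_mul_of_nonneg_left h7 (hM0 t ht)
    _ = _ := mul_comm _ _

/-- A bound for solutions of `v'' = (μ + Q) v`, where `C`, `S` solve `y'' = μ y` with the initial
data of `cosh`, `sinh` and `Q` decays exponentially. -/
theorem norm_le_of_perturbed_ode {C S v v' Q : ℝ → ℂ} {M : ℝ → ℝ} {μ : ℂ} {κ D : ℝ} (hD : 0 ≤ D)
    (hC0 : C 0 = 1) (hS0 : S 0 = 0) (hS : ∀ x, HasDerivAt S (C x) x)
    (hC : ∀ x, HasDerivAt C (μ * S x) x)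
    (hCb : ∀ x, 0 ≤ x → ‖C x‖ ≤ M x * Real.exp (κ * x))
    (hSb : ∀ x, 0 ≤ x → ‖S x‖ ≤ M x * Real.exp (κ * x))
    (hMm : MonotoneOn M (Set.Ici 0)) (hM0 : ∀ t, 0 ≤ t → 0 ≤ M t)
    (hM : ∀ t, 0 ≤ t → M t ≤ 1 + t)
    (hv : ∀ t, 0 ≤ t → HasDerivAt v (v' t) t)
    (hv' : ∀ t, 0 ≤ t → HasDerivAt v' ((μ + Q t) * v t) t)
    (hQ : ContinuousOn Q (Set.Ici 0)) (hQb : ∀ t, 0 ≤ t → ‖Q t‖ ≤ D * Real.exp (-2 * t))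
    {t : ℝ} (ht : 0 ≤ t) :
    ‖v t‖ ≤ (‖v 0‖ + ‖v' 0‖) * Real.exp D * M t * Real.exp (κ * t) := by
  have hvc : ContinuousOn v (Set.Ici 0) := fun t ht => (hv t ht).continuousAt.continuousWithinAt
  have hSc : Continuous S := continuous_iff_continuousAt.2 fun x => (hS x).continuousAt
  -- Variation of constants: the terms with `μ` cancel in the derivative of `v(τ) C(t-τ) + v'(τ)
  -- S(t-τ)`, which runs from the free solution at `τ = 0` to `v(t)` at `τ = t`.
  have duhamel : ∀ t, 0 ≤ t → v t = v 0 * C t + v' 0 * S t +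
      ∫ τ in (0 : ℝ)..t, Q τ * v τ * S (t - τ) := by
    intro t ht
    have hd : ∀ τ ∈ Set.uIcc 0 t, HasDerivAt (fun τ => v τ * C (t - τ) + v' τ * S (t - τ))
        (Q τ * v τ * S (t - τ)) τ := by
      intro τ hτ
      rw [Set.uIcc_of_le ht] at hτ
      have e1 : HasDerivAt (fun τ => C (t - τ)) (-(μ * S (t - τ))) τ :=
        (hC (t - τ)).comp_const_sub t τ
      have e2 : HasDerivAt (fun τ => S (t - τ)) (-(C (t - τ))) τ :=
        (hS (t - τ)).comp_const_sub t τ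
      refine (((hv τ hτ.1).mul e1).add ((hv' τ hτ.1).mul e2)).congr_deriv ?_
      ring
    have hi : IntervalIntegrable (fun τ => Q τ * v τ * S (t - τ)) MeasureTheory.volume 0 t := by
      refine ContinuousOn.intervalIntegrable ?_
      rw [Set.uIcc_of_le ht]
      exact ((hQ.mul hvc).mono Set.Icc_subset_Ici_self).mul
        (by fun_prop : Continuous fun τ => S (t - τ)).continuousOn
    rw [intervalIntegral.integral_eq_sub_of_hasDerivAt hd hi]
    simp [hC0, hS0]
  set u : ℝ → ℝ := fun τ => ‖v τ‖ * Real.exp (-(κ * τ)) with hu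
  have huc : ContinuousOn u (Set.Ici 0) :=
    hvc.norm.mul (by fun_prop : Continuous fun τ : ℝ => Real.exp (-(κ * τ))).continuousOn
  have hmain : ∀ t, 0 ≤ t → u t ≤ M t * ((‖v 0‖ + ‖v' 0‖) +
      ∫ τ in (0 : ℝ)..t, D * Real.exp (-2 * τ) * u τ) := by
    intro t ht
    have h1 : ‖∫ τ in (0 : ℝ)..t, Q τ * v τ * S (t - τ)‖ ≤
        ∫ τ in (0 : ℝ)..t, M t * Real.exp (κ * t) * (D * Real.exp (-2 * τ) * u τ) := by
      refine intervalIntegral.norm_integral_le_of_norm_le ht ?_ ?_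
      · refine MeasureTheory.ae_of_all _ fun τ hτ => ?_
        have hτ0 : 0 ≤ τ := hτ.1.le
        have hs : 0 ≤ t - τ := sub_nonneg.2 hτ.2
        rw [norm_mul, norm_mul]
        calc ‖Q τ‖ * ‖v τ‖ * ‖S (t - τ)‖
            ≤ (D * Real.exp (-2 * τ)) * ‖v τ‖ * (M t * Real.exp (κ * (t - τ))) := by
              gcongr
              · exact hQb τ hτ0
              · refine (hSb _ hs).trans ?_
                gcongr
                exact hMm hs (Set.mem_Ici.2 ht) (by linarith)
          _ = _ := by
              rw [show κ * (t - τ) = κ * t + -(κ * τ) by ring, Real.exp_add]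
              simp only [hu]
              ring
      · refine ContinuousOn.intervalIntegrable ?_
        rw [Set.uIcc_of_le ht]
        exact (((by fun_prop : Continuous fun τ : ℝ => D * Real.exp (-2 * τ)).continuousOn.mul
          huc).mono Set.Icc_subset_Ici_self).const_smul (M t * Real.exp (κ * t))
    rw [intervalIntegral.integral_const_mul] at h1
    have h2 : ‖v t‖ ≤ M t * Real.exp (κ * t) * ((‖v 0‖ + ‖v' 0‖) +
        ∫ τ in (0 : ℝ)..t, D * Real.exp (-2 * τ) * u τ) := by
      rw [duhamel t ht]
      refine (norm_add₃_le).trans ?_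
      rw [norm_mul, norm_mul]
      have := mul_le_mul_of_nonneg_left (hCb t ht) (norm_nonneg (v 0))
      have := mul_le_mul_of_nonneg_left (hSb t ht) (norm_nonneg (v' 0))
      linarith
    have h3 := mul_le_mul_of_nonneg_right h2 (Real.exp_pos (-(κ * t))).le
    refine h3.trans (le_of_eq ?_)
    have h4 : Real.exp (κ * t) * Real.exp (-(κ * t)) = 1 := by
      rw [← Real.exp_add, add_neg_cancel, Real.exp_zero]
    linear_combination M t * ((‖v 0‖ + ‖v' 0‖) +
        ∫ τ in (0 : ℝ)..t, D * Real.exp (-2 * τ) * u τ) * h4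
  have h5 := le_mul_exp_of_le_integral (by positivity) hD huc (fun t _ => by positivity) hM0 hM
    hmain ht
  have h6 := mul_le_mul_of_nonneg_right h5 (Real.exp_pos (κ * t)).le
  refine le_trans (le_of_eq ?_) h6
  have h4 : Real.exp (-(κ * t)) * Real.exp (κ * t) = 1 := by
    rw [← Real.exp_add, neg_add_cancel, Real.exp_zero]
  simp only [hu]
  linear_combination -‖v t‖ * h4

theorem norm_cosh_le_exp (w : ℂ) : ‖Complex.cosh w‖ ≤ Real.exp |w.re| := by
  rw [Complex.cosh, norm_div, Complex.norm_ofNat, div_le_iff₀ two_pos]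
  refine (norm_add_le _ _).trans ?_
  rw [Complex.norm_exp, Complex.norm_exp, Complex.neg_re]
  have h1 := Real.exp_le_exp.2 (le_abs_self w.re)
  have h2 := Real.exp_le_exp.2 (neg_le_abs w.re)
  linarith

theorem norm_sinh_le_exp (w : ℂ) : ‖Complex.sinh w‖ ≤ Real.exp |w.re| := by
  rw [Complex.sinh, norm_div, Complex.norm_ofNat, div_le_iff₀ two_pos]
  refine (norm_sub_le _ _).trans ?_
  rw [Complex.norm_exp, Complex.norm_exp, Complex.neg_re]
  have h1 := Real.exp_le_exp.2 (le_abs_self w.re)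
  have h2 := Real.exp_le_exp.2 (neg_le_abs w.re)
  linarith

theorem hasDerivAt_complex_ofReal (x : ℝ) : HasDerivAt (fun x : ℝ => (x : ℂ)) 1 x :=
  Complex.ofRealCLM.hasDerivAt.congr_deriv (by simp)

theorem hasDerivAt_cosh_const_mul (s : ℂ) (x : ℝ) :
    HasDerivAt (fun x : ℝ => Complex.cosh (s * x)) (s * Complex.sinh (s * x)) x := by
  have h : HasDerivAt (fun x : ℝ => s * (x : ℂ)) s x :=
    ((hasDerivAt_complex_ofReal x).const_mul s).congr_deriv (mul_one s)
  exact ((Complex.hasDerivAt_cosh (s * x)).comp x h).congr_deriv (mul_comm _ _)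

theorem hasDerivAt_sinh_const_mul (s : ℂ) (x : ℝ) :
    HasDerivAt (fun x : ℝ => Complex.sinh (s * x)) (s * Complex.cosh (s * x)) x := by
  have h : HasDerivAt (fun x : ℝ => s * (x : ℂ)) s x :=
    ((hasDerivAt_complex_ofReal x).const_mul s).congr_deriv (mul_one s)
  exact ((Complex.hasDerivAt_sinh (s * x)).comp x h).congr_deriv (mul_comm _ _)

theorem norm_sinh_le_mul_exp (s : ℂ) {x : ℝ} (hx : 0 ≤ x) :
    ‖Complex.sinh (s * x)‖ ≤ ‖s‖ * (x * Real.exp (|s.re| * x)) := by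
  have h := (convex_Icc (0 : ℝ) x).norm_image_sub_le_of_norm_hasDerivWithin_le
    (f := fun x : ℝ => Complex.sinh (s * x)) (C := ‖s‖ * Real.exp (|s.re| * x))
    (fun y _ => (hasDerivAt_sinh_const_mul s y).hasDerivWithinAt) (fun y hy => by
      rw [norm_mul]
      gcongr
      refine (norm_cosh_le_exp _).trans (Real.exp_le_exp.2 ?_)
      rw [Complex.re_mul_ofReal, abs_mul, abs_of_nonneg hy.1]
      exact mul_le_mul_of_nonneg_left hy.2 (abs_nonneg _))
    (Set.left_mem_Icc.2 hx) (Set.right_mem_Icc.2 hx)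
  simp only [Complex.ofReal_zero, mul_zero, Complex.sinh_zero, sub_zero,
    Real.norm_of_nonneg hx] at h
  linarith

/-- Solutions of `v'' = (s ^ 2 + Q) v` with exponentially decaying `Q`, uniformly in `s`. -/
theorem norm_le_of_schroedinger {v v' Q : ℝ → ℂ} {s : ℂ} {D : ℝ} (hD : 0 ≤ D)
    (hv : ∀ t, 0 ≤ t → HasDerivAt v (v' t) t)
    (hv' : ∀ t, 0 ≤ t → HasDerivAt v' ((s ^ 2 + Q t) * v t) t)
    (hQ : ContinuousOn Q (Set.Ici 0)) (hQb : ∀ t, 0 ≤ t → ‖Q t‖ ≤ D * Real.exp (-2 * t))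
    {t : ℝ} (ht : 0 ≤ t) :
    ‖v t‖ ≤ (‖v 0‖ + ‖v' 0‖) * Real.exp D * (1 + t) * Real.exp (|s.re| * t) ∧
    (s ≠ 0 → ‖v t‖ ≤
      (‖v 0‖ + ‖v' 0‖) * Real.exp D * (1 + ‖s‖⁻¹) * Real.exp (|s.re| * t)) := by
  by_cases hs : s = 0
  · subst hs
    refine ⟨?_, fun h => absurd rfl h⟩
    refine norm_le_of_perturbed_ode (C := fun _ => 1) (S := fun x => x) (M := fun x => 1 + x)
      (μ := 0 ^ 2) hD rfl (by simp) (fun x => ?_) (fun x => ?_) ?_ ?_ ?_ ?_ ?_ hv hv' hQ hQb ht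
    · exact hasDerivAt_complex_ofReal x
    · exact (hasDerivAt_const x (1 : ℂ)).congr_deriv (by simp)
    · intro x hx
      simpa using hx
    · intro x hx
      simp [abs_of_nonneg hx]
    · intro x _ y _ hxy
      simpa using hxy
    · intro x hx
      positivity
    · exact fun x _ => le_rfl
  · have hs' : 0 < ‖s‖ := norm_pos_iff.2 hs
    have key := norm_le_of_perturbed_ode (C := fun x => Complex.cosh (s * x))
      -- `|sinh(sx)/s|` is at most both `x` and `1/|s|` times `exp(|Re s| x)`. This minimum yields
      -- the two alternative bounds, the first of which survives as `s → 0`.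
      (S := fun x => s⁻¹ * Complex.sinh (s * x)) (M := fun x => 1 + min x ‖s‖⁻¹) (κ := |s.re|)
      (μ := s ^ 2) hD (by simp) (by simp) (fun x => ?_) (fun x => ?_) ?_ ?_ ?_ ?_ ?_ hv hv' hQ hQb
      ht
    · have hK : 0 ≤ (‖v 0‖ + ‖v' 0‖) * Real.exp D := by positivity
      constructor
      · refine key.trans ?_
        gcongr
        exact min_le_left _ _
      · intro _
        refine key.trans ?_
        gcongr
        exact min_le_right _ _
    · refine ((hasDerivAt_sinh_const_mul s x).const_mul s⁻¹).congr_deriv ?_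
      field_simp
    · refine (hasDerivAt_cosh_const_mul s x).congr_deriv ?_
      field_simp
    · intro x hx
      have h1 := norm_cosh_le_exp (s * x)
      rw [Complex.re_mul_ofReal, abs_mul, abs_of_nonneg hx] at h1
      refine h1.trans (le_mul_of_one_le_left (Real.exp_pos _).le ?_)
      have : 0 ≤ min x ‖s‖⁻¹ := le_min hx (by positivity)
      linarith
    · intro x hx
      have h1 := norm_sinh_le_exp (s * x)
      rw [Complex.re_mul_ofReal, abs_mul, abs_of_nonneg hx] at h1
      have h2 := norm_sinh_le_mul_exp s hx
      rw [norm_mul, norm_inv, inv_mul_le_iff₀ hs']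
      have h3 : ‖Complex.sinh (s * x)‖ ≤
          ‖s‖ * (min x ‖s‖⁻¹ * Real.exp (|s.re| * x)) := by
        rcases min_choice x ‖s‖⁻¹ with h | h
        · rw [h]
          exact h2
        · rw [h, ← mul_assoc, mul_inv_cancel₀ hs'.ne', one_mul]
          exact h1
      refine h3.trans ?_
      gcongr
      linarith
    · intro x _ y _ hxy
      exact add_le_add le_rfl (min_le_min_right _ hxy)
    · intro x hx
      have : 0 ≤ min x ‖s‖⁻¹ := le_min hx (by positivity)
      linarith
    · intro x _
      simp

/-! ### Liouville normal form in the variable `z = tanh² t` -/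

theorem Real.hasDerivAt_tanh_one_sub_sq (t : ℝ) : HasDerivAt Real.tanh (1 - Real.tanh t ^ 2) t := by
  have hc := (Real.cosh_pos t).ne'
  have h := (Real.hasDerivAt_sinh t).div (Real.hasDerivAt_cosh t) hc
  have e : Real.tanh = Real.sinh / Real.cosh := by
    funext x
    exact Real.tanh_eq_sinh_div_cosh x
  rw [e]
  refine h.congr_deriv ?_
  rw [Pi.div_apply]
  field_simp

theorem Real.tanh_pos {t : ℝ} (ht : 0 < t) : 0 < Real.tanh t := by
  rw [Real.tanh_eq_sinh_div_cosh]
  exact div_pos (Real.sinh_pos_iff.2 ht) (Real.cosh_pos t)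

theorem Real.tanh_mono {t₀ t : ℝ} (h : t₀ ≤ t) : Real.tanh t₀ ≤ Real.tanh t := by
  have hd : Differentiable ℝ Real.tanh := fun x =>
    (Real.hasDerivAt_tanh_one_sub_sq x).differentiableAt
  refine monotone_of_deriv_nonneg hd (fun x => ?_) h
  rw [(Real.hasDerivAt_tanh_one_sub_sq x).deriv]
  exact sub_nonneg.2 (Real.tanh_sq_lt_one x).le

theorem Real.one_sub_tanh_sq_le (t : ℝ) : 1 - Real.tanh t ^ 2 ≤ 4 * Real.exp (-2 * t) := by
  have hc := Real.cosh_pos t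
  have h1 : 1 - Real.tanh t ^ 2 = 1 / Real.cosh t ^ 2 := by
    rw [Real.tanh_eq_sinh_div_cosh, div_pow, eq_div_iff (by positivity), sub_mul,
      div_mul_cancel₀ _ (by positivity), Real.cosh_sq]
    ring
  have h2 : Real.exp t / 2 ≤ Real.cosh t := by
    rw [Real.cosh_eq]
    linarith [Real.exp_pos (-t)]
  have h3 : Real.exp (-2 * t) * (Real.exp t * Real.exp t) = 1 := by
    rw [← Real.exp_add, ← Real.exp_add, ← Real.exp_zero]
    congr 1
    ring
  rw [h1, div_le_iff₀ (by positivity)]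
  have h4 : (Real.exp t / 2) ^ 2 ≤ Real.cosh t ^ 2 := by gcongr
  nlinarith [Real.exp_pos (-2 * t)]

theorem hasDerivAt_ofReal_tanh (t : ℝ) :
    HasDerivAt (fun t : ℝ => (Real.tanh t : ℂ)) (1 - (Real.tanh t : ℂ) ^ 2) t :=
  (Real.hasDerivAt_tanh_one_sub_sq t).ofReal_comp.congr_deriv (by push_cast; rfl)

theorem norm_ofReal_tanh_sq_lt_one (t : ℝ) : ‖(Real.tanh t : ℂ) ^ 2‖ < 1 := by
  rw [norm_pow, Complex.norm_real, Real.norm_eq_abs, sq_abs]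
  exact Real.tanh_sq_lt_one t

/-- The factor `tanh(t) ^ p * cosh(t) ^ (-s)` of the Liouville transformation. -/
noncomputable def liouvilleFactor (p : ℝ) (s : ℂ) (t : ℝ) : ℂ :=
  ((Real.tanh t ^ p : ℝ) : ℂ) * Complex.exp (-s * (Real.log (Real.cosh t) : ℝ))

/-- The hypergeometric function in Liouville normal form. -/
noncomputable def liouvilleHyp (a b : ℂ) (p : ℝ) (s : ℂ) (t : ℝ) : ℂ :=
  liouvilleFactor p s t * ordinaryHypergeometric a b (p + 1 / 2 : ℂ) ((Real.tanh t : ℂ) ^ 2)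

/-- The derivative of `liouvilleHyp`. -/
noncomputable def liouvilleHypDeriv (a b : ℂ) (p : ℝ) (s : ℂ) (t : ℝ) : ℂ :=
  liouvilleFactor p s t *
    ((p * ((Real.tanh t : ℂ)⁻¹ - Real.tanh t) - s * Real.tanh t) *
        ordinaryHypergeometric a b (p + 1 / 2 : ℂ) ((Real.tanh t : ℂ) ^ 2) +
      2 * Real.tanh t * (1 - (Real.tanh t : ℂ) ^ 2) * (a * b / (p + 1 / 2) *
        ordinaryHypergeometric (a + 1) (b + 1) (p + 1 / 2 + 1 : ℂ) ((Real.tanh t : ℂ) ^ 2)))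

/-- The decaying part of the potential of the Liouville normal form. -/
noncomputable def liouvillePotential (a b : ℂ) (p : ℝ) (t : ℝ) : ℂ :=
  (1 - (Real.tanh t : ℂ) ^ 2) *
    (p * (p - 1) / (Real.tanh t : ℂ) ^ 2 - ((a - b) ^ 2 - 1 / 4))

theorem hasDerivAt_liouvilleFactor (p : ℝ) (s : ℂ) {t : ℝ} (ht : 0 < t) :
    HasDerivAt (liouvilleFactor p s) (liouvilleFactor p s t *
      (p * ((Real.tanh t : ℂ)⁻¹ - Real.tanh t) - s * Real.tanh t)) t := by
  have hT := Real.tanh_pos ht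
  have h1 := ((Real.hasDerivAt_tanh_one_sub_sq t).rpow_const (p := p) (Or.inl hT.ne')).ofReal_comp
  have h2 : HasDerivAt (fun t => Real.log (Real.cosh t)) (Real.tanh t) t :=
    ((Real.hasDerivAt_cosh t).log (Real.cosh_pos t).ne').congr_deriv
      (Real.tanh_eq_sinh_div_cosh t).symm
  have h3 := (h2.ofReal_comp.const_mul (-s)).cexp
  refine (h1.mul h3).congr_deriv ?_
  have hTc : (Real.tanh t : ℂ) ≠ 0 := by exact_mod_cast hT.ne'
  rw [liouvilleFactor, Real.rpow_sub_one hT.ne']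
  push_cast
  field_simp
  ring

theorem hasDerivAt_hyp_tanh_sq (a b c : ℂ) (t : ℝ) :
    HasDerivAt (fun t : ℝ => ordinaryHypergeometric a b c ((Real.tanh t : ℂ) ^ 2))
      (2 * Real.tanh t * (1 - (Real.tanh t : ℂ) ^ 2) * (a * b / c *
        ordinaryHypergeometric (a + 1) (b + 1) (c + 1) ((Real.tanh t : ℂ) ^ 2))) t := by
  have h1 : HasDerivAt (fun t : ℝ => (Real.tanh t : ℂ) ^ 2)
      (2 * Real.tanh t * (1 - (Real.tanh t : ℂ) ^ 2)) t :=
    ((hasDerivAt_ofReal_tanh t).pow 2).congr_deriv (by norm_num)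
  exact ((hasDerivAt_ordinaryHypergeometric a b c (norm_ofReal_tanh_sq_lt_one t)).comp t
    h1).congr_deriv (mul_comm _ _)

theorem hasDerivAt_liouvilleHyp (a b : ℂ) (p : ℝ) (s : ℂ) {t : ℝ} (ht : 0 < t) :
    HasDerivAt (liouvilleHyp a b p s) (liouvilleHypDeriv a b p s t) t := by
  refine ((hasDerivAt_liouvilleFactor p s ht).mul
    (hasDerivAt_hyp_tanh_sq a b (p + 1 / 2) t)).congr_deriv ?_
  rw [liouvilleHypDeriv]
  ring

/-- The exponents of `liouvilleFactor` are those which remove the first-order term of the Gauss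
equation. What remains is the constant `s²` and a potential with the factor `1 - tanh² t`. -/
theorem hasDerivAt_liouvilleHypDeriv (a b : ℂ) {p : ℝ} (hp : 0 ≤ p) {s : ℂ}
    (hs : a + b = s + (p + 1 / 2)) {t : ℝ} (ht : 0 < t) :
    HasDerivAt (liouvilleHypDeriv a b p s)
      ((s ^ 2 + liouvillePotential a b p t) * liouvilleHyp a b p s t) t := by
  have hTc : (Real.tanh t : ℂ) ≠ 0 := by exact_mod_cast (Real.tanh_pos ht).ne'
  have hT := hasDerivAt_ofReal_tanh t
  have h1 := hasDerivAt_liouvilleFactor p s ht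
  have h2 := ((hT.inv hTc).sub hT).const_mul (p : ℂ) |>.sub (hT.const_mul s)
  have h3 := hasDerivAt_hyp_tanh_sq a b (p + 1 / 2) t
  have h4 := ((hT.const_mul 2).mul ((hT.pow 2).const_sub 1))
  have h5 := (hasDerivAt_hyp_tanh_sq (a + 1) (b + 1) (p + 1 / 2 + 1) t).const_mul
    (a * b / (p + 1 / 2))
  have h6 := h1.mul ((h2.mul h3).add (h4.mul h5))
  refine h6.congr_deriv ?_
  have hc : ∀ k : ℕ, (p + 1 / 2 : ℂ) + k ≠ 0 := by
    intro k h
    have h7 := congrArg Complex.re h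
    simp at h7
    have : (0 : ℝ) ≤ k := k.cast_nonneg
    linarith
  have ode := ordinaryHypergeometric_ode a b (p + 1 / 2) hc (norm_ofReal_tanh_sq_lt_one t)
    rfl rfl rfl
  simp only [Pi.add_apply, Pi.sub_apply, Pi.mul_apply, Pi.pow_apply, Pi.inv_apply]
  rw [liouvilleHyp, liouvillePotential]
  set T : ℂ := (Real.tanh t : ℂ)
  set g := liouvilleFactor p s t
  set F := ordinaryHypergeometric a b (p + 1 / 2 : ℂ) (T ^ 2)
  generalize ordinaryHypergeometric (a + 1 + 1) (b + 1 + 1) (p + 1 / 2 + 1 + 1 : ℂ) (T ^ 2) = G₂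
    at *
  generalize ordinaryHypergeometric (a + 1) (b + 1) (p + 1 / 2 + 1 : ℂ) (T ^ 2) = G₁ at *
  generalize hu : a * b / (p + 1 / 2 : ℂ) = u at *
  generalize (a + 1) * (b + 1) / (p + 1 / 2 + 1 : ℂ) = w at *
  obtain rfl : s = a + b - (p + 1 / 2) := by rw [hs]; ring
  field_simp
  norm_num
  -- After clearing denominators the difference of the two sides is this multiple of the Gauss
  -- equation at `z = T²`.
  linear_combination (64 * T ^ 2 * (1 - T ^ 2) * g) * ode

theorem norm_liouvillePotential_le (a b : ℂ) (p : ℝ) {T₀ t : ℝ} (hT₀ : 0 < T₀)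
    (h : T₀ ≤ Real.tanh t) :
    ‖liouvillePotential a b p t‖ ≤
      4 * (|p * (p - 1)| / T₀ ^ 2 + ‖(a - b) ^ 2 - 1 / 4‖) * Real.exp (-2 * t) := by
  have hT : 0 < Real.tanh t := hT₀.trans_le h
  have e1 : ‖1 - (Real.tanh t : ℂ) ^ 2‖ = 1 - Real.tanh t ^ 2 := by
    rw [show 1 - (Real.tanh t : ℂ) ^ 2 = ((1 - Real.tanh t ^ 2 : ℝ) : ℂ) by push_cast; rfl,
      Complex.norm_real, Real.norm_of_nonneg (sub_nonneg.2 (Real.tanh_sq_lt_one t).le)]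
  have e2 : ‖(p : ℂ) * (p - 1) / (Real.tanh t : ℂ) ^ 2‖ ≤ |p * (p - 1)| / T₀ ^ 2 := by
    rw [show (p : ℂ) * (p - 1) / (Real.tanh t : ℂ) ^ 2 =
      ((p * (p - 1) / Real.tanh t ^ 2 : ℝ) : ℂ) by push_cast; rfl, Complex.norm_real,
      Real.norm_eq_abs, abs_div, abs_of_pos (pow_pos hT 2)]
    gcongr
  rw [liouvillePotential, norm_mul, e1]
  calc _ ≤ (4 * Real.exp (-2 * t)) * (|p * (p - 1)| / T₀ ^ 2 + ‖(a - b) ^ 2 - 1 / 4‖) := by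
        refine mul_le_mul (Real.one_sub_tanh_sq_le t) ((norm_sub_le _ _).trans ?_)
          (norm_nonneg _) (by positivity)
        gcongr
    _ = _ := by ring

theorem continuousAt_liouvillePotential (a b : ℂ) (p : ℝ) {t : ℝ} (ht : 0 < t) :
    ContinuousAt (liouvillePotential a b p) t := by
  have hTc : (Real.tanh t : ℂ) ^ 2 ≠ 0 := pow_ne_zero 2 (by exact_mod_cast (Real.tanh_pos ht).ne')
  have hT := ((hasDerivAt_ofReal_tanh t).continuousAt).pow 2
  exact (continuousAt_const.sub hT).mul ((continuousAt_const.div hT hTc).sub continuousAt_const)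

/-- Propagation of a bound on the Liouville normal form from `t₀` to `t`. -/
theorem norm_liouvilleHyp_le (a b : ℂ) {p : ℝ} (hp : 0 ≤ p) {s : ℂ}
    (hs : a + b = s + (p + 1 / 2)) {t₀ T₀ t D : ℝ} (ht₀ : 0 < t₀) (ht : t₀ ≤ t) (hT₀ : 0 < T₀)
    (hT : T₀ ≤ Real.tanh t₀)
    (hD : 4 * (|p * (p - 1)| / T₀ ^ 2 + ‖(a - b) ^ 2 - 1 / 4‖) ≤ D) :
    ‖liouvilleHyp a b p s t‖ ≤ (‖liouvilleHyp a b p s t₀‖ + ‖liouvilleHypDeriv a b p s t₀‖) *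
      Real.exp D * (1 + t) * Real.exp (|s.re| * t) ∧
    (s ≠ 0 → ‖liouvilleHyp a b p s t‖ ≤
      (‖liouvilleHyp a b p s t₀‖ + ‖liouvilleHypDeriv a b p s t₀‖) *
        Real.exp D * (1 + ‖s‖⁻¹) * Real.exp (|s.re| * t)) := by
  have hD0 : 0 ≤ D := le_trans (by positivity) hD
  have hpos : ∀ x, 0 ≤ x → 0 < x + t₀ := fun x hx => by linarith
  have hQc : ContinuousOn (fun x => liouvillePotential a b p (x + t₀)) (Set.Ici 0) := by
    intro x hx
    refine ContinuousAt.continuousWithinAt ?_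
    exact ContinuousAt.comp (f := fun x => x + t₀) (continuousAt_liouvillePotential a b p
      (hpos x hx)) (by fun_prop)
  have key := norm_le_of_schroedinger (v := fun x => liouvilleHyp a b p s (x + t₀))
    (v' := fun x => liouvilleHypDeriv a b p s (x + t₀))
    (Q := fun x => liouvillePotential a b p (x + t₀)) (s := s) hD0
    (fun x hx => (hasDerivAt_liouvilleHyp a b p s (hpos x hx)).comp_add_const x t₀)
    (fun x hx => (hasDerivAt_liouvilleHypDeriv a b hp hs (hpos x hx)).comp_add_const x t₀) hQc
    (fun x hx => by
      refine (norm_liouvillePotential_le a b p hT₀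
        (hT.trans (Real.tanh_mono (by linarith)))).trans ?_
      exact mul_le_mul hD (Real.exp_le_exp.2 (by linarith)) (Real.exp_pos _).le hD0)
    (sub_nonneg.2 ht)
  simp only [sub_add_cancel, zero_add] at key
  have hK : 0 ≤ (‖liouvilleHyp a b p s t₀‖ + ‖liouvilleHypDeriv a b p s t₀‖) * Real.exp D := by
    positivity
  have ht0 : 0 ≤ t := by linarith
  constructor
  · refine key.1.trans ?_
    gcongr <;> linarith
  · intro h
    refine (key.2 h).trans ?_
    gcongr
    linarith

/-! ### Return from the normal form to the hypergeometric function -/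

theorem norm_liouvilleFactor (p : ℝ) (s : ℂ) {t : ℝ} (ht : 0 < t) :
    ‖liouvilleFactor p s t‖ =
      Real.tanh t ^ p * Real.exp (-(s.re * Real.log (Real.cosh t))) := by
  rw [liouvilleFactor, norm_mul, Complex.norm_real,
    Real.norm_of_nonneg (Real.rpow_nonneg (Real.tanh_pos ht).le p), Complex.norm_exp]
  congr 2
  rw [Complex.re_mul_ofReal, Complex.neg_re, neg_mul]

/-- The weight `cosh(t) ^ σ * exp(|σ| t)`. -/
noncomputable def coshWeight (σ t : ℝ) : ℝ :=
  Real.exp (|σ| * t) * Real.exp (σ * Real.log (Real.cosh t))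

theorem norm_hyp_tanh_sq_eq (a b : ℂ) (p : ℝ) (s : ℂ) {t : ℝ} (ht : 0 < t) :
    Real.tanh t ^ p * ‖ordinaryHypergeometric a b (p + 1 / 2 : ℂ) ((Real.tanh t : ℂ) ^ 2)‖ =
      ‖liouvilleHyp a b p s t‖ * Real.exp (s.re * Real.log (Real.cosh t)) := by
  rw [liouvilleHyp, norm_mul, norm_liouvilleFactor p s ht]
  have h : Real.exp (-(s.re * Real.log (Real.cosh t))) *
      Real.exp (s.re * Real.log (Real.cosh t)) = 1 := by
    rw [← Real.exp_add, neg_add_cancel, Real.exp_zero]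
  linear_combination -Real.tanh t ^ p *
    ‖ordinaryHypergeometric a b (p + 1 / 2 : ℂ) ((Real.tanh t : ℂ) ^ 2)‖ * h

theorem norm_hyp_tanh_sq_le (a b : ℂ) {p : ℝ} (hp : 0 ≤ p) {s : ℂ}
    (hs : a + b = s + (p + 1 / 2)) {t₀ T₀ t D K : ℝ} (ht₀ : 0 < t₀) (ht : t₀ ≤ t) (hT₀ : 0 < T₀)
    (hT : T₀ ≤ Real.tanh t₀)
    (hD : 4 * (|p * (p - 1)| / T₀ ^ 2 + ‖(a - b) ^ 2 - 1 / 4‖) ≤ D)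
    (hK : ‖liouvilleHyp a b p s t₀‖ + ‖liouvilleHypDeriv a b p s t₀‖ ≤ K) :
    Real.tanh t ^ p * ‖ordinaryHypergeometric a b (p + 1 / 2 : ℂ) ((Real.tanh t : ℂ) ^ 2)‖ ≤
      K * Real.exp D * (1 + t) * coshWeight s.re t ∧
    (s ≠ 0 →
      Real.tanh t ^ p * ‖ordinaryHypergeometric a b (p + 1 / 2 : ℂ) ((Real.tanh t : ℂ) ^ 2)‖ ≤
        K * Real.exp D * (1 + ‖s‖⁻¹) * coshWeight s.re t) := by
  have key := norm_liouvilleHyp_le a b hp hs ht₀ ht hT₀ hT hD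
  have ht0 : 0 < t := ht₀.trans_le ht
  rw [norm_hyp_tanh_sq_eq a b p s ht0, coshWeight]
  constructor
  · rw [← mul_assoc]
    refine mul_le_mul_of_nonneg_right (key.1.trans ?_) (Real.exp_pos _).le
    gcongr
  · intro h
    rw [← mul_assoc]
    refine mul_le_mul_of_nonneg_right ((key.2 h).trans ?_) (Real.exp_pos _).le
    gcongr

theorem log_cosh_le {t : ℝ} (ht : 0 ≤ t) : Real.log (Real.cosh t) ≤ t := by
  rw [Real.log_le_iff_le_exp (Real.cosh_pos t), Real.cosh_eq]
  have := Real.exp_le_exp.2 (neg_le_self ht)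
  linarith

theorem sub_log_two_le_log_cosh (t : ℝ) : t - Real.log 2 ≤ Real.log (Real.cosh t) := by
  rw [Real.le_log_iff_exp_le (Real.cosh_pos t), Real.exp_sub, Real.exp_log two_pos, Real.cosh_eq]
  have := Real.exp_pos (-t)
  linarith

/-- Since `log cosh t` is `t` up to `log 2`, the growth of the solution and the decay of `cosh^σ`
cancel. For `σ ≥ 0` they reinforce each other and give `exp(2σt)`, a power of `(1 + tanh t)/(1 -
tanh t)`. -/
theorem coshWeight_le_of_nonpos {σ t : ℝ} (hσ : σ ≤ 0) :
    coshWeight σ t ≤ Real.exp (|σ| * Real.log 2) := by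
  rw [coshWeight, ← Real.exp_add]
  refine Real.exp_le_exp.2 ?_
  rw [abs_of_nonpos hσ]
  nlinarith [sub_log_two_le_log_cosh t]

theorem coshWeight_le_of_nonneg {σ t : ℝ} (hσ : 0 ≤ σ) (ht : 0 ≤ t) :
    coshWeight σ t ≤ Real.exp (2 * t) ^ σ := by
  rw [coshWeight, ← Real.exp_add, ← Real.exp_mul]
  refine Real.exp_le_exp.2 ?_
  rw [abs_of_nonneg hσ]
  nlinarith [log_cosh_le ht]

theorem exp_two_mul_eq_tanh (t : ℝ) :
    Real.exp (2 * t) = (1 + Real.tanh t) / (1 - Real.tanh t) := by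
  have h := Real.tanh_lt_one t
  rw [eq_div_iff (by linarith), Real.tanh_eq]
  have h1 : 0 < Real.exp t + Real.exp (-t) := by positivity
  have h2 : Real.exp (2 * t) * Real.exp (-t) = Real.exp t := by
    rw [← Real.exp_add]
    congr 1
    ring
  field_simp
  linear_combination 2 * h2

theorem exp_two_mul_le_tanh (t : ℝ) : Real.exp (2 * t) ≤ 2 / (1 - Real.tanh t) := by
  have h := Real.tanh_lt_one t
  rw [exp_two_mul_eq_tanh]
  gcongr
  linarith

/-! ### Cauchy data at the origin for `c = 1/2` and `c = 3/2` -/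

open Filter Topology in
/-- The Cauchy data at `0` of the even (`p = 0`) and odd (`p = 1`) solutions. -/
theorem exists_liouville_data_le_two (a b : ℂ) {p : ℝ} (hp : p = 0 ∨ p = 1) (s : ℂ) {t : ℝ}
    (ht : 0 < t) : ∃ t₀, 0 < t₀ ∧ t₀ ≤ t ∧
      ‖liouvilleHyp a b p s t₀‖ + ‖liouvilleHypDeriv a b p s t₀‖ ≤ 2 := by
  have hT : Continuous fun t : ℝ => (Real.tanh t : ℂ) :=
    continuous_iff_continuousAt.2 fun t => (hasDerivAt_ofReal_tanh t).continuousAt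
  have hF : ∀ a b c : ℂ, Continuous fun t : ℝ =>
      ordinaryHypergeometric a b c ((Real.tanh t : ℂ) ^ 2) := fun a b c =>
    continuous_iff_continuousAt.2 fun t => (hasDerivAt_hyp_tanh_sq a b c t).continuousAt
  have hE : Continuous fun t : ℝ => Complex.exp (-s * (Real.log (Real.cosh t) : ℝ)) := by
    refine Complex.continuous_exp.comp (continuous_const.mul (Complex.continuous_ofReal.comp ?_))
    exact Real.continuous_cosh.log fun t => (Real.cosh_pos t).ne'
  -- The term `p / tanh t` in the derivative is only apparently singular: its coefficient vanishes
  -- for `p = 0`, and `tanh^p` cancels it for `p = 1`. The data extend continuously to `(1, 0)` or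
  -- `(0, 1)`, so their sum stays below `2` near `0`, uniformly bounded whatever `s` is.
  have key : ∃ f : ℝ → ℝ, Continuous f ∧ f 0 = 1 ∧ ∀ t, 0 < t →
      ‖liouvilleHyp a b p s t‖ + ‖liouvilleHypDeriv a b p s t‖ = f t := by
    rcases hp with rfl | rfl
    · refine ⟨fun t => ‖Complex.exp (-s * (Real.log (Real.cosh t) : ℝ)) *
          ordinaryHypergeometric a b ((0 : ℝ) + 1 / 2 : ℂ) ((Real.tanh t : ℂ) ^ 2)‖ +
        ‖Complex.exp (-s * (Real.log (Real.cosh t) : ℝ)) * (-s * Real.tanh t *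
          ordinaryHypergeometric a b ((0 : ℝ) + 1 / 2 : ℂ) ((Real.tanh t : ℂ) ^ 2) +
          2 * Real.tanh t * (1 - (Real.tanh t : ℂ) ^ 2) * (a * b / ((0 : ℝ) + 1 / 2) *
        ordinaryHypergeometric (a + 1) (b + 1) ((0 : ℝ) + 1 / 2 + 1 : ℂ)
          ((Real.tanh t : ℂ) ^ 2)))‖, ?_, ?_, ?_⟩
      · exact (hE.mul (hF _ _ _)).norm.add (hE.mul (((continuous_const.mul hT).mul
          (hF _ _ _)).add (((continuous_const.mul hT).mul (continuous_const.sub (hT.pow 2))).mul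
          (continuous_const.mul (hF _ _ _))))).norm
      · simp
      · intro t _
        rw [liouvilleHyp, liouvilleHypDeriv, liouvilleFactor, Real.rpow_zero]
        congr 2
        · push_cast
          ring
        · push_cast
          ring
    · refine ⟨fun t => ‖Real.tanh t * Complex.exp (-s * (Real.log (Real.cosh t) : ℝ)) *
          ordinaryHypergeometric a b ((1 : ℝ) + 1 / 2 : ℂ) ((Real.tanh t : ℂ) ^ 2)‖ +
        ‖Complex.exp (-s * (Real.log (Real.cosh t) : ℝ)) *
          ((1 - (Real.tanh t : ℂ) ^ 2 - s * (Real.tanh t : ℂ) ^ 2) *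
          ordinaryHypergeometric a b ((1 : ℝ) + 1 / 2 : ℂ) ((Real.tanh t : ℂ) ^ 2) +
          2 * (Real.tanh t : ℂ) ^ 2 * (1 - (Real.tanh t : ℂ) ^ 2) * (a * b / ((1 : ℝ) + 1 / 2) *
        ordinaryHypergeometric (a + 1) (b + 1) ((1 : ℝ) + 1 / 2 + 1 : ℂ)
          ((Real.tanh t : ℂ) ^ 2)))‖, ?_, ?_, ?_⟩
      · exact ((hT.mul hE).mul (hF _ _ _)).norm.add (hE.mul ((((continuous_const.sub
          (hT.pow 2)).sub (continuous_const.mul (hT.pow 2))).mul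
          (hF _ _ _)).add (((continuous_const.mul (hT.pow 2)).mul (continuous_const.sub
          (hT.pow 2))).mul (continuous_const.mul (hF _ _ _))))).norm
      · simp
      · intro t ht
        have hTc : (Real.tanh t : ℂ) ≠ 0 := by exact_mod_cast (Real.tanh_pos ht).ne'
        rw [liouvilleHyp, liouvilleHypDeriv, liouvilleFactor, Real.rpow_one]
        congr 2
        generalize (Real.tanh t : ℂ) = T at hTc
        simp only [Complex.ofReal_one]
        field_simp
  obtain ⟨f, hf, hf0, hfe⟩ := key
  have h1 : ∀ᶠ x in 𝓝[>] (0 : ℝ), f x < 2 := by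
    refine (hf.tendsto 0).eventually_lt_const (by rw [hf0]; norm_num) |>.filter_mono
      nhdsWithin_le_nhds
  have h2 : ∀ᶠ x in 𝓝[>] (0 : ℝ), x ∈ Set.Ioc 0 t := Ioc_mem_nhdsGT ht
  obtain ⟨t₀, h3, h4⟩ := (h1.and h2).exists
  exact ⟨t₀, h4.1, h4.2, (hfe t₀ h4.1).trans_le h3.le⟩

/-- Bound for the hypergeometric functions with `c = 1/2` and `c = 3/2`. -/
theorem norm_hyp_tanh_sq_le_of_regular (a b : ℂ) {p : ℝ} (hp : p = 0 ∨ p = 1) {s : ℂ}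
    (hs : a + b = s + (p + 1 / 2)) {t D : ℝ} (ht : 0 < t)
    (hD : 4 * ‖(a - b) ^ 2 - 1 / 4‖ ≤ D) :
    Real.tanh t ^ p * ‖ordinaryHypergeometric a b (p + 1 / 2 : ℂ) ((Real.tanh t : ℂ) ^ 2)‖ ≤
      2 * Real.exp D * (1 + t) * coshWeight s.re t ∧
    (s ≠ 0 →
      Real.tanh t ^ p * ‖ordinaryHypergeometric a b (p + 1 / 2 : ℂ) ((Real.tanh t : ℂ) ^ 2)‖ ≤
        2 * Real.exp D * (1 + ‖s‖⁻¹) * coshWeight s.re t) := by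
  obtain ⟨t₀, h0, h1, h2⟩ := exists_liouville_data_le_two a b hp s ht
  -- The `1/tanh²` part of the potential disappears, so `D` does not depend on `t₀`, which may be
  -- arbitrarily close to `0`.
  have hpp : p * (p - 1) = 0 := by rcases hp with rfl | rfl <;> simp
  refine norm_hyp_tanh_sq_le a b (by rcases hp with rfl | rfl <;> simp) hs h0 h1
    (Real.tanh_pos h0) le_rfl ?_ h2
  simpa [hpp] using hD

/-! ### The inner series for small argument and its Cauchy data -/

/-- Consecutive coefficients have a ratio of modulus at most `((k + 1 + M)/(k + 1))²`, which is
exactly the ratio for the squared binomials. -/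
theorem norm_ordinaryHypergeometricCoefficient_le {a b : ℂ} {c : ℝ} (hc : 1 ≤ c) {M : ℕ}
    (ha : ‖a‖ ≤ M + 1) (hb : ‖b‖ ≤ M + 1) (k : ℕ) :
    ‖ordinaryHypergeometricCoefficient a b (c : ℂ) k‖ ≤ ((k + M).choose M : ℝ) ^ 2 := by
  induction k with
  | zero => simp [ordinaryHypergeometricCoefficient]
  | succ k ih =>
    have hk : (0 : ℝ) ≤ k := k.cast_nonneg
    have hck : (c : ℂ) + k ≠ 0 := by
      rw [show (c : ℂ) + k = ((c + k : ℝ) : ℂ) by push_cast; rfl, Complex.ofReal_ne_zero]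
      linarith
    have h := ordinaryHypergeometricCoefficient_recurrence a b (c : ℂ) k hck
    generalize ordinaryHypergeometricCoefficient a b (c : ℂ) (k + 1) = t' at h ⊢
    generalize ordinaryHypergeometricCoefficient a b (c : ℂ) k = t at h ih
    replace h := congrArg norm h
    rw [norm_mul, norm_mul, norm_mul, norm_mul,
      show (k : ℂ) + 1 = ((k + 1 : ℝ) : ℂ) by push_cast; rfl,
      show (c : ℂ) + k = ((c + k : ℝ) : ℂ) by push_cast; rfl, Complex.norm_real, Complex.norm_real,
      Real.norm_of_nonneg (by linarith), Real.norm_of_nonneg (by linarith)] at h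
    have h1 : ∀ w : ℂ, ‖w‖ ≤ M + 1 → ‖w + k‖ ≤ k + 1 + M := fun w hw => by
      refine (norm_add_le _ _).trans ?_
      rw [Complex.norm_natCast]
      linarith
    have h2 : (((k + 1 + M).choose M : ℕ) : ℝ) * (k + 1) = ((k + M).choose M : ℕ) * (k + 1 + M) := by
      have := Nat.choose_mul_succ_eq (k + M) M
      rw [show k + M + 1 - M = k + 1 by omega, show k + M + 1 = k + 1 + M by omega] at this
      exact_mod_cast this.symm
    have h3 : 0 < ((k : ℝ) + 1) * (c + k) := by positivity
    have h4 : ‖t'‖ * ((k + 1 : ℝ) * (k + 1)) ≤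
        (((k + 1 + M).choose M : ℕ) : ℝ) ^ 2 * ((k + 1 : ℝ) * (k + 1)) := by
      calc _ ≤ ‖t'‖ * ((k + 1 : ℝ) * (c + k)) :=
            mul_le_mul_of_nonneg_left (mul_le_mul_of_nonneg_left (by linarith) (by linarith))
              (norm_nonneg _)
        _ = ‖a + k‖ * ‖b + k‖ * ‖t‖ := by
          rw [← h]
          ring
        _ ≤ (k + 1 + M) * (k + 1 + M) * ((k + M).choose M : ℝ) ^ 2 := by
          gcongr
          · exact h1 a ha
          · exact h1 b hb
        _ = ((((k + M).choose M : ℕ) : ℝ) * (k + 1 + M)) ^ 2 := by ring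
        _ = _ := by
          rw [← h2]
          ring
    exact le_of_mul_le_mul_right h4 (by positivity)

/-- The terms `x_k = C(k + M, M) r^k` are nonnegative with sum `S = (1 - r)^(-(M+1))`. Each is at
most `S`, so `∑ x_k² ≤ S²`. -/
theorem norm_ordinaryHypergeometric_sq_le {a b : ℂ} {c : ℝ} (hc : 1 ≤ c) {M : ℕ}
    (ha : ‖a‖ ≤ M + 1) (hb : ‖b‖ ≤ M + 1) {r : ℝ} (hr0 : 0 ≤ r) (hr1 : r < 1) :
    ‖ordinaryHypergeometric a b (c : ℂ) ((r : ℂ) ^ 2)‖ ≤ (1 / (1 - r)) ^ (2 * (M + 1)) := by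
  have hrn : ‖r‖ < 1 := by rwa [Real.norm_of_nonneg hr0]
  have hz : ‖(r : ℂ) ^ 2‖ < 1 := by
    rw [norm_pow, Complex.norm_real, Real.norm_of_nonneg hr0]
    exact pow_lt_one₀ hr0 hr1 two_ne_zero
  have hS := (summable_choose_mul_geometric_of_norm_lt_one M hrn).hasSum
  rw [tsum_choose_mul_geometric_of_norm_lt_one M hrn] at hS
  set S := 1 / (1 - r) ^ (M + 1) with hSdef
  have hle : ∀ k : ℕ, ((k + M).choose M : ℝ) * r ^ k ≤ S := fun k =>
    le_hasSum hS k fun j _ => by positivity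
  have hterm : ∀ k : ℕ, ‖ordinaryHypergeometricCoefficient a b (c : ℂ) k * ((r : ℂ) ^ 2) ^ k‖ ≤
      S * (((k + M).choose M : ℝ) * r ^ k) := by
    intro k
    rw [norm_mul, norm_pow, norm_pow, Complex.norm_real, Real.norm_of_nonneg hr0]
    calc _ ≤ ((k + M).choose M : ℝ) ^ 2 * (r ^ 2) ^ k := by
          gcongr
          exact norm_ordinaryHypergeometricCoefficient_le hc ha hb k
      _ = (((k + M).choose M : ℝ) * r ^ k) * (((k + M).choose M : ℝ) * r ^ k) := by ring
      _ ≤ _ := by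
          gcongr
          exact hle k
  rw [← (hasSum_ordinaryHypergeometric a b (c : ℂ) hz).tsum_eq]
  refine (tsum_of_norm_bounded (hS.mul_left S) hterm).trans (le_of_eq ?_)
  rw [hSdef, pow_mul', one_div_pow]
  ring

theorem one_div_pow_le_exp {r : ℝ} (hr : r ≤ 1 / 8) (k : ℕ) :
    (1 / (1 - r)) ^ k ≤ Real.exp (k / 7) := by
  have h1 : 1 / (1 - r) ≤ Real.exp (1 / 7) := by
    refine le_trans ?_ (Real.add_one_le_exp _)
    rw [div_le_iff₀ (by linarith)]
    linarith
  calc (1 / (1 - r)) ^ k ≤ Real.exp (1 / 7) ^ k := by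
        have : 0 ≤ 1 / (1 - r) := by
          apply div_nonneg <;> linarith
        gcongr
    _ = Real.exp (k / 7) := by
        rw [← Real.exp_nat_mul]
        congr 1
        ring

/-- For small `r` the inner hypergeometric function grows slowly in the order. -/
theorem norm_inner_hyp_le (α : ℂ) {c : ℝ} (hc : 1 ≤ c) {r : ℝ} (hr0 : 0 ≤ r) (hr : r ≤ 1 / 8) :
    ‖ordinaryHypergeometric (α / 2) ((α + 1) / 2) (c : ℂ) ((r : ℂ) ^ 2)‖ ≤
        Real.exp ((‖α‖ + 5) / 7) ∧
    ‖ordinaryHypergeometric (α / 2 + 1) ((α + 1) / 2 + 1) (c + 1 : ℂ) ((r : ℂ) ^ 2)‖ ≤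
        Real.exp ((‖α‖ + 5) / 7) := by
  -- The least integer dominating both parameters; the exponent `2(M + 1)` stays below `|α| + 5`,
  -- and `1/(1 - r) ≤ exp(1/7)` for `r ≤ 1/8`.
  set M := ⌈(‖α‖ + 1) / 2⌉₊ with hM
  have h1 : (‖α‖ + 1) / 2 ≤ M := Nat.le_ceil _
  have h2 : (M : ℝ) < (‖α‖ + 1) / 2 + 1 := Nat.ceil_lt_add_one (by positivity)
  have e1 : ‖α / 2‖ = ‖α‖ / 2 := by simp
  have e2 : ‖(α + 1) / 2‖ ≤ (‖α‖ + 1) / 2 := by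
    rw [norm_div, Complex.norm_ofNat]
    gcongr
    exact (norm_add_le _ _).trans (by simp)
  have e3 : ‖α / 2 + 1‖ ≤ ‖α / 2‖ + 1 := (norm_add_le _ _).trans (by simp)
  have e4 : ‖(α + 1) / 2 + 1‖ ≤ ‖(α + 1) / 2‖ + 1 := (norm_add_le _ _).trans (by simp)
  have h3 : Real.exp ((2 * (M + 1) : ℕ) / 7) ≤ Real.exp ((‖α‖ + 5) / 7) := by
    apply Real.exp_le_exp.2
    push_cast
    linarith
  have h4 := (one_div_pow_le_exp hr (2 * (M + 1))).trans h3
  have hn := norm_nonneg α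
  constructor
  · exact (norm_ordinaryHypergeometric_sq_le hc (by linarith) (by linarith) hr0
      (by linarith)).trans h4
  · have := norm_ordinaryHypergeometric_sq_le (a := α / 2 + 1) (b := (α + 1) / 2 + 1) (c := c + 1)
      (M := M) (by linarith) (by linarith) (by linarith) hr0 (by linarith)
    push_cast at this
    exact this.trans h4

/-- The Cauchy data of the inner solution at the point where `tanh t₀ = 1 / 8`. -/
theorem exists_inner_data_le {p : ℝ} (hp : 1 / 2 ≤ p) (R : ℝ) {t₀ : ℝ} (ht₀ : 0 < t₀)
    (hT : Real.tanh t₀ = 1 / 8) :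
    ∃ C : ℝ, 0 < C ∧ ∀ α s : ℂ, 0 < α.re → α.re ≤ R → s = α - p →
      ‖liouvilleHyp (α / 2) ((α + 1) / 2) p s t₀‖ +
        ‖liouvilleHypDeriv (α / 2) ((α + 1) / 2) p s t₀‖ ≤ C * Real.exp (|α.im| / 4) := by
  -- The series grows at rate `1/7` in `|Im α|`; the gap up to `1/4` absorbs the quadratic
  -- polynomial from the derivative.
  obtain ⟨C₁, hC₁, h₁⟩ := exists_add_pow_le_mul_exp (|R| + 8 * p + 3) (by positivity) 2
    (ε := 1 / 4 - 1 / 7) (by norm_num)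
  refine ⟨Real.exp ((|R| + p) * t₀) * (3 * C₁) * Real.exp ((|R| + 5) / 7), by positivity,
    fun α s h0 hR hs => ?_⟩
  have hRabs : R ≤ |R| := le_abs_self R
  have hre : |α.re| ≤ |R| := by
    rw [abs_of_pos h0]
    linarith
  have hα : ‖α‖ ≤ |R| + |α.im| := (Complex.norm_le_abs_re_add_abs_im α).trans (by linarith)
  have hg : ‖liouvilleFactor p s t₀‖ ≤ Real.exp ((|R| + p) * t₀) := by
    rw [norm_liouvilleFactor p s ht₀, hT]
    have h1 : ((1 : ℝ) / 8) ^ p ≤ 1 := Real.rpow_le_one (by norm_num) (by norm_num) (by linarith)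
    have h2 : -(s.re * Real.log (Real.cosh t₀)) ≤ (|R| + p) * t₀ := by
      have h3 := log_cosh_le ht₀.le
      have h4 : 0 ≤ Real.log (Real.cosh t₀) := Real.log_nonneg (Real.one_le_cosh t₀)
      have h5 : -s.re ≤ |R| + p := by
        rw [hs]
        simp
        linarith [abs_nonneg R]
      calc -(s.re * Real.log (Real.cosh t₀)) = -s.re * Real.log (Real.cosh t₀) := by ring
        _ ≤ (|R| + p) * Real.log (Real.cosh t₀) := by gcongr
        _ ≤ _ := by gcongr
    calc _ ≤ 1 * Real.exp ((|R| + p) * t₀) := by gcongr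
      _ = _ := one_mul _
  obtain ⟨hF, hG⟩ := norm_inner_hyp_le α (c := p + 1 / 2) (by linarith) (r := 1 / 8)
    (by norm_num) le_rfl
  have hE : Real.exp ((‖α‖ + 5) / 7) ≤ Real.exp ((|R| + 5) / 7) * Real.exp (1 / 7 * |α.im|) := by
    rw [← Real.exp_add]
    apply Real.exp_le_exp.2
    linarith
  replace hF := hF.trans hE
  replace hG := hG.trans hE
  set E := Real.exp ((|R| + 5) / 7) * Real.exp (1 / 7 * |α.im|) with hEdef
  set P := |R| + 8 * p + 3 + |α.im| with hP
  have hP1 : 1 ≤ P := by linarith [abs_nonneg R, abs_nonneg α.im]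
  have hPP : P ≤ P ^ 2 := by nlinarith
  have hE0 : 0 < E := by positivity
  rw [liouvilleHyp, liouvilleHypDeriv, hT]
  push_cast at hF hG ⊢
  set F := ordinaryHypergeometric (α / 2) ((α + 1) / 2) (p + 1 / 2 : ℂ) ((1 / 8 : ℂ) ^ 2)
  set G := ordinaryHypergeometric (α / 2 + 1) ((α + 1) / 2 + 1) (p + 1 / 2 + 1 : ℂ)
    ((1 / 8 : ℂ) ^ 2)
  have k1 : ‖(p : ℂ) * ((1 / 8 : ℂ)⁻¹ - 1 / 8) - s * (1 / 8)‖ ≤ P := by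
    rw [hs, show (p : ℂ) * ((1 / 8 : ℂ)⁻¹ - 1 / 8) - (α - p) * (1 / 8) =
      ((8 * p : ℝ) : ℂ) - α * (1 / 8) by push_cast; ring]
    refine (norm_sub_le _ _).trans ?_
    rw [Complex.norm_real, Real.norm_of_nonneg (by linarith), norm_mul]
    norm_num
    linarith [norm_nonneg α]
  have k2 : ‖α / 2 * ((α + 1) / 2) / (p + 1 / 2 : ℂ)‖ ≤ P ^ 2 := by
    rw [norm_div, norm_mul, norm_div, norm_div, Complex.norm_ofNat,
      show (p : ℂ) + 1 / 2 = ((p + 1 / 2 : ℝ) : ℂ) by push_cast; rfl, Complex.norm_real,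
      Real.norm_of_nonneg (by linarith), div_le_iff₀ (by linarith)]
    have h1 : ‖α + 1‖ ≤ ‖α‖ + 1 := (norm_add_le _ _).trans (by simp)
    have h2 := norm_nonneg α
    have h3 := norm_nonneg (α + 1)
    calc ‖α‖ / 2 * (‖α + 1‖ / 2) ≤ P * P := by
          gcongr <;> linarith
      _ = P ^ 2 * 1 := by ring
      _ ≤ _ := by
          gcongr
          linarith
  have k3 : ‖(2 : ℂ) * (1 / 8) * (1 - (1 / 8) ^ 2)‖ ≤ 1 := by norm_num
  have k4 : ‖F‖ + ‖(p * ((1 / 8 : ℂ)⁻¹ - 1 / 8) - s * (1 / 8)) * F +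
      2 * (1 / 8) * (1 - (1 / 8) ^ 2) * (α / 2 * ((α + 1) / 2) / (p + 1 / 2 : ℂ) * G)‖ ≤
      3 * P ^ 2 * E := by
    have h1 : ‖(p * ((1 / 8 : ℂ)⁻¹ - 1 / 8) - s * (1 / 8)) * F‖ ≤ P ^ 2 * E := by
      rw [norm_mul]
      exact mul_le_mul (k1.trans hPP) hF (norm_nonneg _) (by positivity)
    have h2 : ‖2 * (1 / 8) * (1 - (1 / 8) ^ 2) *
        (α / 2 * ((α + 1) / 2) / (p + 1 / 2 : ℂ) * G)‖ ≤ 1 * (P ^ 2 * E) := by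
      rw [norm_mul, norm_mul (α / 2 * ((α + 1) / 2) / (p + 1 / 2 : ℂ))]
      exact mul_le_mul k3 (mul_le_mul k2 hG (norm_nonneg _) (by positivity)) (by positivity)
        zero_le_one
    have h3 : ‖F‖ ≤ P ^ 2 * E := hF.trans (le_mul_of_one_le_left hE0.le (hP1.trans hPP))
    have h4 := norm_add_le ((p * ((1 / 8 : ℂ)⁻¹ - 1 / 8) - s * (1 / 8)) * F)
      (2 * (1 / 8) * (1 - (1 / 8) ^ 2) * (α / 2 * ((α + 1) / 2) / (p + 1 / 2 : ℂ) * G))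
    linarith
  rw [norm_mul, norm_mul, ← mul_add]
  calc _ ≤ Real.exp ((|R| + p) * t₀) * (3 * P ^ 2 * E) :=
        mul_le_mul hg k4 (by positivity) (by positivity)
    _ ≤ Real.exp ((|R| + p) * t₀) * (3 * (C₁ * Real.exp ((1 / 4 - 1 / 7) * |α.im|)) * E) := by
        gcongr
        exact h₁ _ (abs_nonneg _)
    _ = _ := by
        rw [show |α.im| / 4 = (1 / 4 - 1 / 7) * |α.im| + 1 / 7 * |α.im| by ring, Real.exp_add, hEdef]
        ring

/-! ### Singular weights at `y = 1` and the inner hypergeometric function -/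

/-- The two admissible factors in the bounds near the singular point `y = 1`. -/
def IsSingularFactor (s : ℂ) (y L : ℝ) : Prop :=
  L = 2 + |Real.log (1 - y)| ∨ (s ≠ 0 ∧ L = 1 + ‖s‖⁻¹)

theorem IsSingularFactor.one_le {s : ℂ} {y L : ℝ} (h : IsSingularFactor s y L) : 1 ≤ L := by
  rcases h with rfl | ⟨-, rfl⟩
  · linarith [abs_nonneg (Real.log (1 - y))]
  · exact le_add_of_nonneg_right (by positivity)

/-- The power singularity `(1 - y) ^ (-σ)` if `0 ≤ σ`, a constant otherwise. -/
noncomputable def powerWeight (σ y : ℝ) : ℝ := (2 / (1 - y)) ^ max σ 0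

theorem one_le_powerWeight {σ y : ℝ} (hy0 : 0 ≤ y) (hy : y < 1) : 1 ≤ powerWeight σ y := by
  refine Real.one_le_rpow ?_ (le_max_right _ _)
  rw [le_div_iff₀ (by linarith)]
  linarith

theorem coshWeight_le {σ S t : ℝ} (hσ : |σ| ≤ S) (ht : 0 ≤ t) :
    coshWeight σ t ≤ Real.exp (S * Real.log 2) * powerWeight σ (Real.tanh t) := by
  have hl : 0 ≤ Real.log 2 := Real.log_nonneg one_le_two
  have h1 := Real.tanh_lt_one t
  rw [powerWeight]
  rcases le_total σ 0 with h | h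
  · rw [max_eq_right h, Real.rpow_zero, mul_one]
    refine (coshWeight_le_of_nonpos h).trans (Real.exp_le_exp.2 ?_)
    gcongr
  · rw [max_eq_left h]
    refine (coshWeight_le_of_nonneg h ht).trans ?_
    have h2 : Real.exp (2 * t) ^ σ ≤ (2 / (1 - Real.tanh t)) ^ σ :=
      Real.rpow_le_rpow (Real.exp_pos _).le (exp_two_mul_le_tanh t) h
    refine h2.trans (le_mul_of_one_le_left ?_ (Real.one_le_exp ?_))
    · exact Real.rpow_nonneg (div_nonneg zero_le_two (by linarith)) _
    · exact mul_nonneg ((abs_nonneg σ).trans hσ) hl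

theorem one_add_le_log_tanh {t : ℝ} : 1 + t ≤ 2 + |Real.log (1 - Real.tanh t)| := by
  have h1 := Real.tanh_lt_one t
  have h2 := Real.log_le_log (Real.exp_pos _) (exp_two_mul_le_tanh t)
  rw [Real.log_exp, Real.log_div two_ne_zero (by linarith)] at h2
  have h3 := neg_le_abs (Real.log (1 - Real.tanh t))
  have h4 := Real.log_two_lt_d9
  linarith [abs_nonneg (Real.log (1 - Real.tanh t))]

theorem le_singular_of_le_coshWeight {X K S t L : ℝ} {s : ℂ} (hK : 0 ≤ K) (ht : 0 ≤ t)
    (hS : |s.re| ≤ S) (hL : IsSingularFactor s (Real.tanh t) L)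
    (h : X ≤ K * (1 + t) * coshWeight s.re t ∧ (s ≠ 0 → X ≤ K * (1 + ‖s‖⁻¹) * coshWeight s.re t)) :
    X ≤ K * Real.exp (S * Real.log 2) * (L * powerWeight s.re (Real.tanh t)) := by
  have hW : 0 ≤ coshWeight s.re t := by
    rw [coshWeight]
    positivity
  have h1 : X ≤ K * L * coshWeight s.re t := by
    rcases hL with rfl | ⟨hs, rfl⟩
    · refine h.1.trans ?_
      gcongr K * ?_ * _
      exact one_add_le_log_tanh
    · exact h.2 hs
  have hL0 : 0 ≤ L := zero_le_one.trans hL.one_le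
  calc X ≤ K * L * coshWeight s.re t := h1
    _ ≤ K * L * (Real.exp (S * Real.log 2) * powerWeight s.re (Real.tanh t)) := by
        gcongr
        exact coshWeight_le hS ht
    _ = _ := by ring

theorem exists_tanh_eq {y : ℝ} (h0 : 0 < y) (h1 : y < 1) : ∃ t, 0 < t ∧ Real.tanh t = y :=
  ⟨Real.artanh y, Real.artanh_pos ⟨h0, h1⟩, Real.tanh_artanh ⟨by linarith, h1⟩⟩

/-- Bound for the inner hypergeometric function. -/
theorem exists_inner_hyp_le {p : ℝ} (hp : 1 / 2 ≤ p) (R : ℝ) :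
    ∃ C : ℝ, 0 < C ∧ ∀ α s : ℂ, 0 < α.re → α.re ≤ R → s = α - p → ∀ r L : ℝ, 0 ≤ r → r < 1 →
      IsSingularFactor s r L →
      ‖ordinaryHypergeometric (α / 2) ((α + 1) / 2) (p + 1 / 2 : ℂ) ((r : ℂ) ^ 2)‖ ≤
        C * Real.exp (|α.im| / 4) * (L * powerWeight s.re r) := by
  obtain ⟨t₀, ht₀, hT₀⟩ := exists_tanh_eq (y := 1 / 8) (by norm_num) (by norm_num)
  obtain ⟨C₁, hC₁, h₁⟩ := exists_inner_data_le hp R ht₀ hT₀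
  set D := 4 * (|p * (p - 1)| / (1 / 8) ^ 2) with hD
  set K := C₁ * Real.exp D * Real.exp ((|R| + p) * Real.log 2) * 8 ^ p with hK
  refine ⟨K + Real.exp ((|R| + 5) / 7), by positivity, fun α s h0 hR hs r L hr0 hr1 hL => ?_⟩
  have hL1 := hL.one_le
  have hW1 := one_le_powerWeight (σ := s.re) hr0 hr1
  have hRabs : R ≤ |R| := le_abs_self R
  rcases lt_or_ge r (1 / 8) with hr | hr
  · have h2 := (norm_inner_hyp_le α (c := p + 1 / 2) (by linarith) hr0 hr.le).1
    push_cast at h2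
    refine h2.trans ?_
    have hα : ‖α‖ ≤ |R| + |α.im| := (Complex.norm_le_abs_re_add_abs_im α).trans (by
      rw [abs_of_pos h0]
      linarith)
    have h3 : Real.exp ((‖α‖ + 5) / 7) ≤ Real.exp ((|R| + 5) / 7) * Real.exp (|α.im| / 4) := by
      rw [← Real.exp_add]
      apply Real.exp_le_exp.2
      linarith [abs_nonneg α.im]
    have hK0 : 0 ≤ K := by positivity
    calc _ ≤ Real.exp ((|R| + 5) / 7) * Real.exp (|α.im| / 4) := h3
      _ ≤ (K + Real.exp ((|R| + 5) / 7)) * Real.exp (|α.im| / 4) := by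
        gcongr
        linarith
      _ ≤ _ := le_mul_of_one_le_right (by positivity) (one_le_mul_of_one_le_of_one_le hL1 hW1)
  · obtain ⟨t, ht, hT⟩ := exists_tanh_eq (y := r) (by linarith) hr1
    have htt : t₀ ≤ t := by
      by_contra! h
      have hm := Real.tanh_mono h.le
      have heq : Real.tanh t = Real.tanh t₀ := le_antisymm hm (by rw [hT, hT₀]; exact hr)
      exact h.ne (Real.tanh_injective heq)
    have hsum : α / 2 + (α + 1) / 2 = s + (p + 1 / 2) := by
      rw [hs]
      ring
    have h2 := norm_hyp_tanh_sq_le (α / 2) ((α + 1) / 2) (by linarith : 0 ≤ p) hsum ht₀ htt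
      (T₀ := 1 / 8) (by norm_num) hT₀.ge (D := D) (le_of_eq (by
        rw [show (α / 2 - (α + 1) / 2) ^ 2 - 1 / 4 = 0 by ring, norm_zero, add_zero]))
      (h₁ α s h0 hR hs)
    have hS : |s.re| ≤ |R| + p := by
      rw [hs, abs_le]
      simp
      constructor <;> linarith [abs_nonneg R]
    have h3 := le_singular_of_le_coshWeight (by positivity) ht.le hS (by rwa [hT]) h2
    rw [hT] at h3
    -- The estimate from the normal form carries a factor `tanh^p t = r^p`, which is harmless
    -- because `r ≥ 1/8` here.
    have h4 : 1 ≤ 8 ^ p * r ^ p := by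
      rw [← Real.mul_rpow (by norm_num) hr0]
      exact Real.one_le_rpow (by linarith) (by linarith)
    set F := ordinaryHypergeometric (α / 2) ((α + 1) / 2) (p + 1 / 2 : ℂ) ((r : ℂ) ^ 2)
    calc ‖F‖ ≤ (8 ^ p * r ^ p) * ‖F‖ := le_mul_of_one_le_left (norm_nonneg _) h4
      _ = 8 ^ p * (r ^ p * ‖F‖) := by ring
      _ ≤ 8 ^ p * (C₁ * Real.exp (|α.im| / 4) * Real.exp D * Real.exp ((|R| + p) * Real.log 2) *
          (L * powerWeight s.re r)) := by gcongr
      _ = K * Real.exp (|α.im| / 4) * (L * powerWeight s.re r) := by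
          rw [hK]
          ring
      _ ≤ _ := by
          gcongr
          exact le_add_of_nonneg_right (Real.exp_pos _).le

/-! ### Uniform bounds for the symbol on both sides of the sphere -/

/-- The symbol inside the unit sphere. -/
theorem exists_norm_oscSymbol_inner_le {n : ℕ} (hn : 2 ≤ n) {δ : ℝ} (hδ : 0 < δ) :
    ∃ C : ℝ, 0 < C ∧ ∀ α s : ℂ, 0 < α.re → α.re ≤ n → δ ≤ ‖α‖ → s = α - ((n : ℂ) - 1) / 2 →
      ∀ r L : ℝ, 0 ≤ r → r < 1 → IsSingularFactor s r L →
      ‖oscSymbol n α r‖ ≤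
        C * Real.exp (Real.pi / 4 * |α.im|) * (L * powerWeight s.re r) := by
  have hn' : (2 : ℝ) ≤ n := by exact_mod_cast hn
  obtain ⟨C₁, hC₁, h₁⟩ := exists_norm_Gamma_le n δ hδ
  obtain ⟨C₂, hC₂, h₂⟩ := exists_inner_hyp_le (p := ((n : ℝ) - 1) / 2) (by linarith) n
  set A := ‖2 * (Real.pi : ℂ) ^ ((n : ℂ) / 2)‖ * ‖(Complex.Gamma ((n : ℂ) / 2))⁻¹‖ with hA
  refine ⟨(A + 1) * C₁ * C₂, by positivity, fun α s h0 hR hαδ hs r L hr0 hr1 hL => ?_⟩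
  have hs' : s = α - ((((n : ℝ) - 1) / 2 : ℝ) : ℂ) := by
    rw [hs]
    push_cast
    ring
  have h3 := h₂ α s h0 hR hs' r L hr0 hr1 hL
  rw [show ((((n : ℝ) - 1) / 2 : ℝ) : ℂ) + 1 / 2 = (n : ℂ) / 2 by push_cast; ring] at h3
  have h4 := h₁ α h0 hR hαδ
  have h5 : ‖Complex.exp (α * Real.pi * Complex.I / 2)‖ ≤ Real.exp (Real.pi / 2 * |α.im|) := by
    rw [Complex.norm_exp]
    apply Real.exp_le_exp.2
    have h6 : (α * Real.pi * Complex.I / 2).re = Real.pi / 2 * -α.im := by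
      rw [show α * Real.pi * Complex.I / 2 = ((Real.pi / 2 : ℝ) : ℂ) * (α * Complex.I) by
        push_cast; ring, Complex.re_ofReal_mul]
      simp
    rw [h6]
    have := neg_le_abs α.im
    gcongr
  rw [oscSymbol, if_pos hr1]
  set F := ordinaryHypergeometric (α / 2) ((α + 1) / 2) ((n : ℂ) / 2) ((r : ℂ) ^ 2)
  have hLW : 0 ≤ L * powerWeight s.re r := by
    have := hL.one_le
    have := one_le_powerWeight (σ := s.re) hr0 hr1
    positivity
  calc _ = A * ‖Complex.Gamma α‖ * ‖Complex.exp (α * Real.pi * Complex.I / 2)‖ * ‖F‖ := by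
        rw [hA, div_eq_mul_inv]
        simp only [norm_mul]
        ring
    _ ≤ (A + 1) * (C₁ * Real.exp (-(Real.pi / 3) * |α.im|)) * Real.exp (Real.pi / 2 * |α.im|) *
        (C₂ * Real.exp (|α.im| / 4) * (L * powerWeight s.re r)) := by
        gcongr
        linarith
    _ = (A + 1) * C₁ * C₂ * Real.exp (-(Real.pi / 3) * |α.im| + Real.pi / 2 * |α.im| +
        |α.im| / 4) * (L * powerWeight s.re r) := by
        rw [Real.exp_add, Real.exp_add]
        ring
    _ ≤ _ := by
        gcongr
        -- The rates add up to `-π/3 + π/2 + 1/4`, which is at most `π/4` precisely because `π ≥ 3`.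
        have := Real.pi_gt_three
        nlinarith [abs_nonneg α.im]

/-- The symbol outside the unit sphere. -/
theorem exists_norm_oscSymbol_outer_le {n : ℕ} (hn : 2 ≤ n) {δ : ℝ} (hδ : 0 < δ) :
    ∃ C : ℝ, 0 < C ∧ ∀ α s : ℂ, 0 < α.re → α.re ≤ n → δ ≤ ‖α‖ → s = α - ((n : ℂ) - 1) / 2 →
      ∀ r L : ℝ, 1 < r → IsSingularFactor s r⁻¹ L →
      ‖oscSymbol n α r‖ ≤
        C * Real.exp (Real.pi / 4 * |α.im|) * (L * powerWeight s.re r⁻¹) := by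
  have hn' : (2 : ℝ) ≤ n := by exact_mod_cast hn
  -- `δ/2` bounds `|α/2|` from below and `1/2` bounds `|(α + 1)/2|`.
  obtain ⟨C₁, hC₁, h₁⟩ := exists_norm_Gamma_le n (min (δ / 2) (1 / 2)) (by positivity)
  obtain ⟨C₂, hC₂, h₂⟩ := exists_norm_inv_Gamma_le n
  set A := ‖(Real.pi : ℂ) ^ ((n : ℂ) / 2)‖ with hA
  set D := 4 * ‖(((n : ℂ) - 2) / 2) ^ 2 - 1 / 4‖ with hD
  set B := Real.exp ((2 * n : ℝ) * Real.log 2) with hB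
  set K := (2 : ℝ) ^ (n + 1 : ℝ) * (A + 1) * C₁ * C₂ * (2 * Real.exp D * B) with hK
  refine ⟨2 * K, by positivity, fun α s h0 hR hαδ hs r L hr hL => ?_⟩
  have hr0 : 0 < r := by linarith
  have hy0 : 0 < r⁻¹ := inv_pos.2 hr0
  have hy1 : r⁻¹ < 1 := inv_lt_one_of_one_lt₀ hr
  obtain ⟨t, ht, hT⟩ := exists_tanh_eq hy0 hy1
  have hS : |s.re| ≤ 2 * n := by
    rw [hs, show α - ((n : ℂ) - 1) / 2 = α - ((((n : ℝ) - 1) / 2 : ℝ) : ℂ) by push_cast; ring,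
      Complex.sub_re, Complex.ofReal_re, abs_le]
    constructor <;> linarith
  -- All Gamma arguments have imaginary part `±Im α / 2`, so the quotient grows at rate `π/6` at
  -- most.
  have hE : Real.exp (-(Real.pi / 3) * (|α.im| / 2)) * Real.exp (2 * Real.pi / 3 * (|α.im| / 2)) ≤
      Real.exp (Real.pi / 4 * |α.im|) := by
    rw [← Real.exp_add]
    apply Real.exp_le_exp.2
    nlinarith [abs_nonneg α.im, Real.pi_pos]
  have hpow : ∀ w : ℂ, w.re ≤ n + 1 → ‖(2 : ℂ) ^ w‖ ≤ (2 : ℝ) ^ (n + 1 : ℝ) := by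
    intro w hw
    have := Complex.norm_cpow_eq_rpow_re_of_pos two_pos w
    rw [Complex.ofReal_ofNat] at this
    rw [this]
    exact Real.rpow_le_rpow_of_exponent_le one_le_two hw
  have coef : ∀ w g₁ g₂ : ℂ, w.re ≤ n + 1 → 0 < g₁.re → g₁.re ≤ n → min (δ / 2) (1 / 2) ≤ ‖g₁‖ →
      |g₁.im| = |α.im| / 2 → -(1 / 2) ≤ g₂.re → g₂.re ≤ n → |g₂.im| = |α.im| / 2 →
      ‖(2 : ℂ) ^ w * (Real.pi : ℂ) ^ ((n : ℂ) / 2) * Complex.Gamma g₁ / Complex.Gamma g₂‖ ≤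
        (2 : ℝ) ^ (n + 1 : ℝ) * (A + 1) * C₁ * C₂ * Real.exp (Real.pi / 4 * |α.im|) := by
    intro w g₁ g₂ hw hg1 hg2 hg3 hg4 hg5 hg6 hg7
    have e1 := h₁ g₁ hg1 hg2 hg3
    have e2 := h₂ g₂ hg5 hg6
    rw [hg4] at e1
    rw [hg7] at e2
    rw [div_eq_mul_inv, norm_mul, norm_mul, norm_mul]
    calc _ ≤ (2 : ℝ) ^ (n + 1 : ℝ) * (A + 1) * (C₁ * Real.exp (-(Real.pi / 3) * (|α.im| / 2))) *
          (C₂ * Real.exp (2 * Real.pi / 3 * (|α.im| / 2))) := by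
          gcongr
          · exact hpow w hw
          · linarith
      _ = (2 : ℝ) ^ (n + 1 : ℝ) * (A + 1) * C₁ * C₂ *
          (Real.exp (-(Real.pi / 3) * (|α.im| / 2)) *
            Real.exp (2 * Real.pi / 3 * (|α.im| / 2))) := by ring
      _ ≤ _ := by gcongr
  have hrp : ‖(r : ℂ) ^ (-α)‖ ≤ 1 := by
    rw [Complex.norm_cpow_eq_rpow_re_of_pos hr0]
    exact Real.rpow_le_one_of_one_le_of_nonpos hr.le (by simpa using h0.le)
  -- The remaining `r⁻¹ = tanh t` is the factor `tanh^p t` with `p = 1` in the estimate for the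
  -- second series.
  have hrp' : ‖(r : ℂ) ^ (-α - 1)‖ ≤ r⁻¹ := by
    rw [Complex.norm_cpow_eq_rpow_re_of_pos hr0, Complex.sub_re, Complex.one_re,
      Real.rpow_sub_one hr0.ne', div_eq_mul_inv]
    refine mul_le_of_le_one_left hy0.le ?_
    exact Real.rpow_le_one_of_one_le_of_nonpos hr.le (by simpa using h0.le)
  have hz : (1 : ℂ) / (r : ℂ) ^ 2 = (Real.tanh t : ℂ) ^ 2 := by
    rw [hT]
    push_cast
    rw [one_div, inv_pow]
  have hL' : IsSingularFactor s (Real.tanh t) L := by rwa [hT]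
  have f1 := le_singular_of_le_coshWeight (by positivity) ht.le hS hL'
    (norm_hyp_tanh_sq_le_of_regular (α / 2) ((α - n + 2) / 2) (p := 0) (Or.inl rfl) (s := s)
      (by rw [hs]; push_cast; ring) ht (D := D) (le_of_eq (by rw [hD]; congr 2; ring)))
  have f2 := le_singular_of_le_coshWeight (by positivity) ht.le hS hL'
    (norm_hyp_tanh_sq_le_of_regular ((α + 1) / 2) ((α - n + 3) / 2) (p := 1) (Or.inr rfl) (s := s)
      (by rw [hs]; push_cast; ring) ht (D := D) (le_of_eq (by rw [hD]; congr 2; ring)))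
  rw [← hz, hT, Real.rpow_zero, one_mul, Complex.ofReal_zero, zero_add, ← hB] at f1
  rw [← hz, hT, Real.rpow_one, Complex.ofReal_one, show (1 : ℂ) + 1 / 2 = 3 / 2 by norm_num,
    ← hB] at f2
  have hLW : 0 ≤ L * powerWeight s.re r⁻¹ := by
    have := hL.one_le
    have := one_le_powerWeight (σ := s.re) hy0.le hy1
    positivity
  rw [oscSymbol, if_neg (not_lt.2 hr.le)]
  generalize ordinaryHypergeometric (α / 2) ((α - n + 2) / 2) (1 / 2 : ℂ) (1 / (r : ℂ) ^ 2) = F₁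
    at f1 ⊢
  generalize ordinaryHypergeometric ((α + 1) / 2) ((α - n + 3) / 2) (3 / 2 : ℂ)
    (1 / (r : ℂ) ^ 2) = F₂ at f2 ⊢
  have c1 := coef α (α / 2) (((n : ℂ) - α) / 2) (by linarith) (by simpa using h0)
    (by simp; linarith) (by
      rw [norm_div, Complex.norm_ofNat]
      exact (min_le_left _ _).trans (by linarith)) (by simp [abs_div]) (by simp; linarith)
    (by simp; linarith) (by simp [abs_div])
  have c2 := coef (α + 1) ((α + 1) / 2) (((n : ℂ) - α - 1) / 2) (by simp; linarith)
    (by simp; linarith) (by simp; linarith) (by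
      refine (min_le_right _ _).trans (le_trans ?_ (Complex.re_le_norm _))
      simp
      linarith) (by simp [abs_div]) (by simp; linarith)
    (by simp; linarith) (by simp [abs_div])
  set E := Real.exp (Real.pi / 4 * |α.im|) with hEdef
  refine (norm_add_le _ _).trans ?_
  have t1 : ‖(2 : ℂ) ^ α * (Real.pi : ℂ) ^ ((n : ℂ) / 2) * Complex.Gamma (α / 2) /
        Complex.Gamma (((n : ℂ) - α) / 2) * (r : ℂ) ^ (-α) * F₁‖ ≤
      K * E * (L * powerWeight s.re r⁻¹) := by
    rw [norm_mul, norm_mul]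
    calc _ ≤ ((2 : ℝ) ^ (n + 1 : ℝ) * (A + 1) * C₁ * C₂ * E) * 1 *
          (2 * Real.exp D * B * (L * powerWeight s.re r⁻¹)) := by gcongr
      _ = _ := by
          rw [hK]
          ring
  have t2 : ‖Complex.I * ((2 : ℂ) ^ (α + 1) * (Real.pi : ℂ) ^ ((n : ℂ) / 2) *
        Complex.Gamma ((α + 1) / 2) / Complex.Gamma (((n : ℂ) - α - 1) / 2)) *
        (r : ℂ) ^ (-α - 1) * F₂‖ ≤ K * E * (L * powerWeight s.re r⁻¹) := by
    rw [norm_mul, norm_mul, norm_mul, Complex.norm_I, one_mul]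
    calc _ ≤ ((2 : ℝ) ^ (n + 1 : ℝ) * (A + 1) * C₁ * C₂ * E) * r⁻¹ * ‖F₂‖ := by gcongr
      _ = ((2 : ℝ) ^ (n + 1 : ℝ) * (A + 1) * C₁ * C₂ * E) * (r⁻¹ * ‖F₂‖) := by ring
      _ ≤ ((2 : ℝ) ^ (n + 1 : ℝ) * (A + 1) * C₁ * C₂ * E) *
          (2 * Real.exp D * B * (L * powerWeight s.re r⁻¹)) := by gcongr
      _ = _ := by
          rw [hK]
          ring
  calc _ ≤ K * E * (L * powerWeight s.re r⁻¹) + K * E * (L * powerWeight s.re r⁻¹) :=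
        add_le_add t1 t2
    _ = _ := by ring

theorem exists_norm_oscSymbol_le {n : ℕ} (hn : 2 ≤ n) {δ : ℝ} (hδ : 0 < δ) :
    ∃ C : ℝ, 0 < C ∧ ∀ α s : ℂ, 0 < α.re → α.re ≤ n → δ ≤ ‖α‖ → s = α - ((n : ℂ) - 1) / 2 →
      ∀ r L : ℝ, 0 ≤ r → r ≠ 1 → IsSingularFactor s (min r r⁻¹) L →
      ‖oscSymbol n α r‖ ≤
        C * Real.exp (Real.pi / 4 * |α.im|) * (L * powerWeight s.re (min r r⁻¹)) := by
  obtain ⟨C₁, hC₁, h₁⟩ := exists_norm_oscSymbol_inner_le hn hδ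
  obtain ⟨C₂, hC₂, h₂⟩ := exists_norm_oscSymbol_outer_le hn hδ
  refine ⟨C₁ + C₂, by positivity, fun α s h0 hR hαδ hs r L hr0 hr1 hL => ?_⟩
  have hL1 := hL.one_le
  rcases lt_or_gt_of_ne hr1 with h | h
  · have hm : min r r⁻¹ = r := by
      -- At `r = 0` the convention `0⁻¹ = 0` makes the minimum equal to `r` as well.
      rcases hr0.eq_or_lt with rfl | h'
      · simp
      · exact min_eq_left (h.le.trans ((one_le_inv₀ h').2 h.le))
    rw [hm] at hL ⊢
    have hW := one_le_powerWeight (σ := s.re) hr0 h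
    refine (h₁ α s h0 hR hαδ hs r L hr0 h hL).trans ?_
    gcongr
    linarith
  · have hi : r⁻¹ < 1 := inv_lt_one_of_one_lt₀ h
    have hm : min r r⁻¹ = r⁻¹ := min_eq_right (hi.le.trans h.le)
    rw [hm] at hL ⊢
    have hW := one_le_powerWeight (σ := s.re) (inv_nonneg.2 hr0) hi
    refine (h₂ α s h0 hR hαδ hs r L h hL).trans ?_
    gcongr
    linarith

/-! ### Comparison of the weights with `|1 - r|` and of `1/|s|` with `Γ(s)` -/

theorem min_inv_nonneg {r : ℝ} (hr : 0 ≤ r) : 0 ≤ min r r⁻¹ := le_min hr (inv_nonneg.2 hr)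

theorem min_inv_le_half {r : ℝ} (h : r ≤ 1 / 2 ∨ 2 ≤ r) : min r r⁻¹ ≤ 1 / 2 := by
  rcases h with h | h
  · exact (min_le_left _ _).trans h
  · refine (min_le_right _ _).trans ?_
    rw [one_div]
    exact inv_anti₀ two_pos h

theorem min_inv_lt_one {r : ℝ} (hr1 : r ≠ 1) : min r r⁻¹ < 1 := by
  rcases lt_or_gt_of_ne hr1 with h | h
  · exact (min_le_left _ _).trans_lt h
  · exact (min_le_right _ _).trans_lt (inv_lt_one_of_one_lt₀ h)

theorem abs_one_sub_bounds {r : ℝ} (h0 : 1 / 2 < r) (h2 : r < 2) :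
    |1 - r| / 2 ≤ 1 - min r r⁻¹ ∧ 1 - min r r⁻¹ ≤ 1 := by
  have hr : 0 < r := by linarith
  refine ⟨?_, sub_le_self _ (min_inv_nonneg hr.le)⟩
  rcases le_total r 1 with h | h
  · rw [abs_of_nonneg (sub_nonneg.2 h)]
    have := min_le_left r r⁻¹
    linarith
  · rw [abs_of_nonpos (sub_nonpos.2 h)]
    have h3 := min_le_right r r⁻¹
    have h4 : r⁻¹ * r = 1 := inv_mul_cancel₀ hr.ne'
    have h5 : r⁻¹ ≤ 1 := inv_le_one_of_one_le₀ h
    nlinarith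

theorem powerWeight_le_of_le_half {σ y : ℝ} (hσ : σ ≤ 2) (hy0 : 0 ≤ y) (hy : y ≤ 1 / 2) :
    powerWeight σ y ≤ 16 := by
  have h1 : (1 : ℝ) ≤ 2 / (1 - y) := by
    rw [le_div_iff₀ (by linarith)]
    linarith
  have h2 : 2 / (1 - y) ≤ 4 := by
    rw [div_le_iff₀ (by linarith)]
    linarith
  calc powerWeight σ y ≤ (2 / (1 - y)) ^ (2 : ℝ) :=
        Real.rpow_le_rpow_of_exponent_le h1 (max_le hσ zero_le_two)
    _ ≤ 4 ^ (2 : ℝ) := Real.rpow_le_rpow (by linarith) h2 zero_le_two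
    _ = 16 := by norm_num

theorem powerWeight_le_abs_rpow {σ r : ℝ} (hσ0 : 0 ≤ σ) (hσ : σ ≤ 2) (h0 : 1 / 2 < r) (h2 : r < 2)
    (hr1 : r ≠ 1) : powerWeight σ (min r r⁻¹) ≤ 16 * |1 - r| ^ (-σ) := by
  have ha : 0 < |1 - r| := abs_pos.2 (sub_ne_zero.2 hr1.symm)
  have hb := (abs_one_sub_bounds h0 h2).1
  have h3 : 2 / (1 - min r r⁻¹) ≤ 4 * |1 - r|⁻¹ := by
    rw [div_le_iff₀ (by linarith)]
    have h4 : |1 - r|⁻¹ * |1 - r| = 1 := inv_mul_cancel₀ ha.ne'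
    have h5 : 0 < |1 - r|⁻¹ := inv_pos.2 ha
    nlinarith
  rw [powerWeight, max_eq_left hσ0]
  calc _ ≤ (4 * |1 - r|⁻¹) ^ σ :=
        Real.rpow_le_rpow (div_nonneg zero_le_two (by linarith)) h3 hσ0
    _ = 4 ^ σ * |1 - r| ^ (-σ) := by
        rw [Real.mul_rpow (by norm_num) (by positivity), Real.inv_rpow ha.le, Real.rpow_neg ha.le]
    _ ≤ 4 ^ (2 : ℝ) * |1 - r| ^ (-σ) := by
        gcongr
        norm_num
    _ = _ := by norm_num

theorem abs_log_one_sub_min_inv_le {r : ℝ} (h0 : 1 / 2 < r) (h2 : r < 2) (hr1 : r ≠ 1) :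
    |Real.log (1 - min r r⁻¹)| ≤ 1 + |Real.log (|1 - r|)| := by
  have ha : 0 < |1 - r| := abs_pos.2 (sub_ne_zero.2 hr1.symm)
  obtain ⟨h3, h4⟩ := abs_one_sub_bounds h0 h2
  have h5 := Real.log_le_log (by positivity) h3
  rw [Real.log_div ha.ne' two_ne_zero] at h5
  have h6 := Real.log_nonpos (by linarith : 0 ≤ 1 - min r r⁻¹) h4
  rw [abs_of_nonpos h6]
  have := Real.log_two_lt_d9
  linarith [neg_le_abs (Real.log |1 - r|)]

theorem abs_log_one_sub_le_one {y : ℝ} (hy0 : 0 ≤ y) (hy : y ≤ 1 / 2) :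
    |Real.log (1 - y)| ≤ 1 := by
  rw [abs_of_nonpos (Real.log_nonpos (by linarith) (by linarith))]
  have h1 := Real.log_le_log (by norm_num) (by linarith : (1 / 2 : ℝ) ≤ 1 - y)
  rw [one_div, Real.log_inv] at h1
  have := Real.log_two_lt_d9
  linarith

/-- The pole of `Γ` at `0` dominates `1 / |s|`. -/
theorem exists_one_add_inv_norm_le (R : ℝ) : ∃ C : ℝ, 0 < C ∧ ∀ s : ℂ, 0 ≤ s.re → s.re ≤ R →
    s ≠ 0 → 1 + ‖s‖⁻¹ ≤ C * Real.exp (3 * Real.pi / 4 * |s.im|) * ‖Complex.Gamma s‖ := by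
  obtain ⟨C₁, hC₁, h₁⟩ := exists_norm_inv_Gamma_le (R + 1)
  obtain ⟨C₂, hC₂, h₂⟩ := exists_add_pow_le_mul_exp (|R| + 1) (by positivity) 1
    (ε := Real.pi / 12) (by positivity)
  refine ⟨C₁ * C₂, by positivity, fun s h0 hR hs => ?_⟩
  have hs' : 0 < ‖s‖ := norm_pos_iff.2 hs
  have h3 := h₁ (s + 1) (by simp; linarith) (by simpa using hR)
  have hG : 0 < ‖Complex.Gamma (s + 1)‖ :=
    norm_pos_iff.2 (Complex.Gamma_ne_zero_of_re_pos (by simp; linarith))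
  -- `s Γ(s) = Γ(s + 1)` is bounded below at rate `2π/3`; the numerator `|s| + 1` costs `π/12` more,
  -- which gives `3π/4`.
  rw [norm_inv, inv_eq_one_div, div_le_iff₀ hG, Complex.Gamma_add_one s hs, norm_mul] at h3
  have h4 := h₂ |s.im| (abs_nonneg _)
  rw [pow_one] at h4
  have h5 : ‖s‖ + 1 ≤ |R| + 1 + |s.im| := by
    have := Complex.norm_le_abs_re_add_abs_im s
    rw [abs_of_nonneg h0] at this
    linarith [le_abs_self R]
  simp only [Complex.add_im, Complex.one_im, add_zero] at h3
  calc 1 + ‖s‖⁻¹ = (‖s‖ + 1) * ‖s‖⁻¹ * 1 := by field_simp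
    _ ≤ (C₂ * Real.exp (Real.pi / 12 * |s.im|)) * ‖s‖⁻¹ *
        (C₁ * Real.exp (2 * Real.pi / 3 * |s.im|) * (‖s‖ * ‖Complex.Gamma s‖)) := by
        gcongr
        exact h5.trans h4
    _ = C₁ * C₂ * (Real.exp (Real.pi / 12 * |s.im|) * Real.exp (2 * Real.pi / 3 * |s.im|)) *
        ‖Complex.Gamma s‖ := by
        field_simp
    _ = _ := by
        rw [← Real.exp_add]
        congr 3
        ring

theorem re_sub_half (α : ℂ) (n : ℕ) : (α - ((n : ℂ) - 1) / 2).re = α.re - ((n : ℝ) - 1) / 2 := by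
  rw [show α - ((n : ℂ) - 1) / 2 = α - ((((n : ℝ) - 1) / 2 : ℝ) : ℂ) by push_cast; ring,
    Complex.sub_re, Complex.ofReal_re]

theorem im_sub_half (α : ℂ) (n : ℕ) : (α - ((n : ℂ) - 1) / 2).im = α.im := by
  rw [show α - ((n : ℂ) - 1) / 2 = α - ((((n : ℝ) - 1) / 2 : ℝ) : ℂ) by push_cast; ring,
    Complex.sub_im, Complex.ofReal_im, sub_zero]

/-! ### The three estimates -/

/-- Here `Re s ≤ -η < 0`, so the power weight is `1` and `1/|s| ≤ 1/η`: there is no singularity at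
the sphere. -/
theorem exists_norm_oscSymbol_le_of_re_lt {n : ℕ} (hn : 2 ≤ n) {δ₀ δ₁ : ℝ} (h₀ : 0 < δ₀)
    (h₁ : δ₁ < ((n : ℝ) - 1) / 2) :
    ∃ C : ℝ, ∀ α : ℂ, 0 < α.re → α.re ≤ δ₁ → δ₀ ≤ ‖α‖ → ∀ r : ℝ, 0 ≤ r → r ≠ 1 →
      ‖oscSymbol n α r‖ ≤ C * Real.exp (Real.pi / 2 * |α.im|) := by
  have hn' : (2 : ℝ) ≤ n := by exact_mod_cast hn
  obtain ⟨C, hC, h⟩ := exists_norm_oscSymbol_le hn h₀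
  set η := ((n : ℝ) - 1) / 2 - δ₁ with hη
  have hη0 : 0 < η := sub_pos.2 h₁
  refine ⟨C * (1 + η⁻¹), fun α ha0 ha1 hα r hr0 hr1 => ?_⟩
  set s : ℂ := α - ((n : ℂ) - 1) / 2 with hs
  have hsre : s.re ≤ -η := by
    rw [hs, re_sub_half]
    linarith
  have hsn : η ≤ ‖s‖ := by
    have h2 := Complex.abs_re_le_norm s
    linarith [neg_le_abs s.re]
  have hs0 : s ≠ 0 := norm_pos_iff.1 (hη0.trans_le hsn)
  have h3 := h α s ha0 (by linarith) hα hs r _ hr0 hr1 (Or.inr ⟨hs0, rfl⟩)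
  rw [powerWeight, max_eq_right (by linarith), Real.rpow_zero, mul_one] at h3
  calc _ ≤ C * Real.exp (Real.pi / 4 * |α.im|) * (1 + ‖s‖⁻¹) := h3
    _ ≤ C * Real.exp (Real.pi / 2 * |α.im|) * (1 + η⁻¹) := by
        gcongr ?_ * Real.exp ?_ * (1 + ?_)
        · nlinarith [abs_nonneg α.im, Real.pi_pos]
        · exact inv_anti₀ hη0 hsn
    _ = _ := by ring

theorem exists_norm_oscSymbol_le_away {n : ℕ} (hn : 2 ≤ n) :
    ∃ C : ℝ, 0 < C ∧ ∀ α : ℂ, ((n : ℝ) - 1) / 2 ≤ α.re → α.re ≤ ((n : ℝ) + 1) / 2 →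
      ∀ r : ℝ, 0 ≤ r → (r ≤ 1 / 2 ∨ 2 ≤ r) →
        ‖oscSymbol n α r‖ ≤ C * Real.exp (Real.pi * |α.im|) := by
  have hn' : (2 : ℝ) ≤ n := by exact_mod_cast hn
  obtain ⟨C, hC, h⟩ := exists_norm_oscSymbol_le hn (δ := 1 / 2) (by norm_num)
  refine ⟨C * 48, by positivity, fun α ha0 ha1 r hr0 hr => ?_⟩
  have hr1 : r ≠ 1 := by
    rintro rfl
    norm_num at hr
  have hα : 1 / 2 ≤ ‖α‖ := le_trans (by linarith) (Complex.re_le_norm α)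
  -- Away from the sphere the logarithmic factor is bounded, uniformly as `s → 0`; this also covers
  -- `α = (n-1)/2`.
  have h3 := h α _ (by linarith) (by linarith) hα rfl r _ hr0 hr1 (Or.inl rfl)
  rw [re_sub_half] at h3
  have hy0 := min_inv_nonneg hr0
  have hy := min_inv_le_half hr
  have hW := powerWeight_le_of_le_half (σ := α.re - ((n : ℝ) - 1) / 2) (by linarith) hy0 hy
  have hl := abs_log_one_sub_le_one hy0 hy
  have hW1 := one_le_powerWeight (σ := α.re - ((n : ℝ) - 1) / 2) hy0 (by linarith)
  calc _ ≤ _ := h3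
    _ ≤ C * Real.exp (Real.pi * |α.im|) * ((2 + 1) * 16) := by
        gcongr
        linarith [Real.pi_pos]
    _ = _ := by ring

/-- The factor `1 + 1/|s|` is used and traded for `|Γ(s)|` at rate `3π/4`; with the rate `π/4` of
the symbol this makes exactly `π`. -/
theorem exists_norm_oscSymbol_le_near {n : ℕ} (hn : 2 ≤ n) :
    ∃ C : ℝ, 0 < C ∧ ∀ α : ℂ, ((n : ℝ) - 1) / 2 ≤ α.re → α.re ≤ ((n : ℝ) + 1) / 2 →
      α ≠ ((n : ℂ) - 1) / 2 → ∀ r : ℝ, 1 / 2 < r → r < 2 → r ≠ 1 →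
        ‖oscSymbol n α r‖ ≤ C * Real.exp (Real.pi * |α.im|) *
          (‖Complex.Gamma (α - ((n : ℂ) - 1) / 2)‖ *
            (1 + |1 - r| ^ (((n : ℝ) - 1) / 2 - α.re))) := by
  have hn' : (2 : ℝ) ≤ n := by exact_mod_cast hn
  obtain ⟨C, hC, h⟩ := exists_norm_oscSymbol_le hn (δ := 1 / 2) (by norm_num)
  obtain ⟨C₁, hC₁, h₁⟩ := exists_one_add_inv_norm_le 1
  refine ⟨C * C₁ * 16, by positivity, fun α ha0 ha1 hne r hr0 hr2 hr1 => ?_⟩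
  have hα : 1 / 2 ≤ ‖α‖ := le_trans (by linarith) (Complex.re_le_norm α)
  have hre := re_sub_half α n
  have him := im_sub_half α n
  have hs0 : α - ((n : ℂ) - 1) / 2 ≠ 0 := sub_ne_zero.2 hne
  have h3 := h α _ (by linarith) (by linarith) hα rfl r _ (by linarith) hr1 (Or.inr ⟨hs0, rfl⟩)
  have h4 := h₁ _ (by linarith) (by linarith) hs0
  have hW := powerWeight_le_abs_rpow (σ := α.re - ((n : ℝ) - 1) / 2) (by linarith) (by linarith)
    hr0 hr2 hr1
  rw [hre] at h3
  rw [him] at h4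
  rw [neg_sub] at hW
  have hW1 := one_le_powerWeight (σ := α.re - ((n : ℝ) - 1) / 2)
    (min_inv_nonneg (by linarith : 0 ≤ r)) (min_inv_lt_one hr1)
  generalize ‖Complex.Gamma (α - ((n : ℂ) - 1) / 2)‖ = g at h4 ⊢
  have hg : 0 ≤ g := by
    by_contra! hg
    have h5 : 0 < 1 + ‖α - ((n : ℂ) - 1) / 2‖⁻¹ := by positivity
    have h6 : C₁ * Real.exp (3 * Real.pi / 4 * |α.im|) * g < 0 :=
      mul_neg_of_pos_of_neg (by positivity) hg
    linarith
  calc _ ≤ _ := h3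
    _ ≤ C * Real.exp (Real.pi / 4 * |α.im|) * ((C₁ * Real.exp (3 * Real.pi / 4 * |α.im|) * g) *
        (16 * |1 - r| ^ (((n : ℝ) - 1) / 2 - α.re))) := by gcongr
    _ = C * C₁ * 16 * (Real.exp (Real.pi / 4 * |α.im|) * Real.exp (3 * Real.pi / 4 * |α.im|)) *
        (g * |1 - r| ^ (((n : ℝ) - 1) / 2 - α.re)) := by ring
    _ = C * C₁ * 16 * Real.exp (Real.pi * |α.im|) *
        (g * |1 - r| ^ (((n : ℝ) - 1) / 2 - α.re)) := by
        rw [← Real.exp_add]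
        congr 3
        ring
    _ ≤ _ := by
        gcongr
        linarith

theorem exists_norm_oscSymbol_critical_le {n : ℕ} (hn : 2 ≤ n) :
    ∃ C : ℝ, 0 < C ∧ ∀ r : ℝ, 1 / 2 < r → r < 2 → r ≠ 1 →
      ‖oscSymbol n (((n : ℂ) - 1) / 2) r‖ ≤ C * (1 + |Real.log (|1 - r|)|) := by
  have hn' : (2 : ℝ) ≤ n := by exact_mod_cast hn
  obtain ⟨C, hC, h⟩ := exists_norm_oscSymbol_le hn (δ := 1 / 2) (by norm_num)
  refine ⟨C * 3, by positivity, fun r hr0 hr2 hr1 => ?_⟩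
  have e : ((n : ℂ) - 1) / 2 = ((((n : ℝ) - 1) / 2 : ℝ) : ℂ) := by push_cast; ring
  have hre : (((n : ℂ) - 1) / 2).re = ((n : ℝ) - 1) / 2 := by rw [e, Complex.ofReal_re]
  have him : (((n : ℂ) - 1) / 2).im = 0 := by rw [e, Complex.ofReal_im]
  have h3 := h (((n : ℂ) - 1) / 2) 0 (by rw [hre]; linarith) (by rw [hre]; linarith)
    (le_trans (by rw [hre]; linarith) (Complex.re_le_norm _)) (sub_self _).symm r _
    (by linarith) hr1 (Or.inl rfl)
  rw [him, abs_zero, mul_zero, Real.exp_zero, mul_one, powerWeight, Complex.zero_re, max_self,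
    Real.rpow_zero, mul_one] at h3
  refine h3.trans ?_
  rw [mul_assoc]
  gcongr
  have := abs_log_one_sub_min_inv_le hr0 hr2 hr1
  linarith [abs_nonneg (Real.log |1 - r|)]

theorem mainTheorem6 (n : ℕ) (hn : 2 ≤ n) :
    (∀ δ₀ δ₁ : ℝ, 0 < δ₀ → δ₁ < ((n : ℝ) - 1) / 2 →
      ∃ C : ℝ, ∀ α : ℂ, 0 < α.re → α.re ≤ δ₁ → δ₀ ≤ ‖α‖ →
        ∀ ξ : EuclideanSpace ℝ (Fin n), ‖ξ‖ ≠ 1 →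
          ‖oscSymbol n α ‖ξ‖‖ ≤ C * Real.exp (Real.pi / 2 * |α.im|)) ∧
    (∀ δ₂ : ℝ, δ₂ < ((n : ℝ) + 1) / 2 →
      ∃ C : ℝ, ∀ α : ℂ, ((n : ℝ) - 1) / 2 ≤ α.re → α.re ≤ δ₂ → α ≠ ((n : ℂ) - 1) / 2 →
        ∀ ξ : EuclideanSpace ℝ (Fin n),
          (‖ξ‖ ≤ 1 / 2 ∨ 2 ≤ ‖ξ‖ →
            ‖oscSymbol n α ‖ξ‖‖ ≤ C * Real.exp (Real.pi * |α.im|)) ∧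
          (1 / 2 < ‖ξ‖ → ‖ξ‖ < 2 → ‖ξ‖ ≠ 1 →
            ‖oscSymbol n α ‖ξ‖‖ ≤ C * Real.exp (Real.pi * |α.im|) *
              (‖Complex.Gamma (α - ((n : ℂ) - 1) / 2)‖ *
                (1 + |1 - ‖ξ‖| ^ (((n : ℝ) - 1) / 2 - α.re))))) ∧
    (∃ C : ℝ, ∀ ξ : EuclideanSpace ℝ (Fin n),
      (‖ξ‖ ≤ 1 / 2 ∨ 2 ≤ ‖ξ‖ → ‖oscSymbol n (((n : ℂ) - 1) / 2) ‖ξ‖‖ ≤ C) ∧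
      (1 / 2 < ‖ξ‖ → ‖ξ‖ < 2 → ‖ξ‖ ≠ 1 →
        ‖oscSymbol n (((n : ℂ) - 1) / 2) ‖ξ‖‖ ≤ C * (1 + |Real.log (|1 - ‖ξ‖|)|))) := by
  have hn' : (2 : ℝ) ≤ n := by exact_mod_cast hn
  have hre : (((n : ℂ) - 1) / 2).re = ((n : ℝ) - 1) / 2 := by
    rw [show ((n : ℂ) - 1) / 2 = ((((n : ℝ) - 1) / 2 : ℝ) : ℂ) by push_cast; ring,
      Complex.ofReal_re]
  have him : (((n : ℂ) - 1) / 2).im = 0 := by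
    rw [show ((n : ℂ) - 1) / 2 = ((((n : ℝ) - 1) / 2 : ℝ) : ℂ) by push_cast; ring,
      Complex.ofReal_im]
  obtain ⟨C₁, hC₁, h₁⟩ := exists_norm_oscSymbol_le_away hn
  obtain ⟨C₂, hC₂, h₂⟩ := exists_norm_oscSymbol_le_near hn
  obtain ⟨C₃, hC₃, h₃⟩ := exists_norm_oscSymbol_critical_le hn
  refine ⟨fun δ₀ δ₁ h₀ hδ => ?_, fun δ₂ hδ => ⟨C₁ + C₂, fun α ha0 ha1 hne ξ => ⟨fun hξ => ?_,
    fun hξ0 hξ2 hξ1 => ?_⟩⟩, ⟨C₁ + C₃, fun ξ => ⟨fun hξ => ?_, fun hξ0 hξ2 hξ1 => ?_⟩⟩⟩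
  · obtain ⟨C, hC⟩ := exists_norm_oscSymbol_le_of_re_lt hn h₀ hδ
    exact ⟨C, fun α ha0 ha1 hα ξ hξ => hC α ha0 ha1 hα ‖ξ‖ (norm_nonneg ξ) hξ⟩
  · refine (h₁ α ha0 (by linarith) ‖ξ‖ (norm_nonneg ξ) hξ).trans ?_
    gcongr
    linarith
  · refine (h₂ α ha0 (by linarith) hne ‖ξ‖ hξ0 hξ2 hξ1).trans ?_
    gcongr
    linarith
  · have h := h₁ (((n : ℂ) - 1) / 2) hre.ge (by rw [hre]; linarith) ‖ξ‖ (norm_nonneg ξ) hξ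
    rw [him, abs_zero, mul_zero, Real.exp_zero, mul_one] at h
    linarith
  · refine (h₃ ‖ξ‖ hξ0 hξ2 hξ1).trans ?_
    gcongr
    linarith
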